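/- Let $\omega_1,\omega_2\in\mathbb C$ with $\operatorname{Im}(\omega_2/\omega_1)>0$, let $\Lambda=2\mathbb Z\omega_1+2\mathbb Z\omega_2$, and let $$\sigma(x)=x\prod_{s\in\Lambda\setminus\{0\}}\Bigl(1-\frac xs\Bigr)e^{\frac xs+\frac{x^2}{2s^2}},\qquad \zeta(x)=\sigma'(x)/\sigma(x)$$ be the Weierstrass functions of $\Lambda$. Let $N\ge 1$ and let $\eta,x_1,\dots,x_N,p_1,\dots,p_N\in\mathbb C$ be such that $\eta\notin\Lambda$ and, for $i\ne j$, $x_i-x_j\notin\Lambda$ and $x_i-x_j-\eta\notin\Lambda$. Put $$\dot x_i=e^{p_i}\prod_{j\ne i}\frac{\sigma(x_i-x_j+\eta)}{\sigma(x_i-x_j)},\qquad \overset{\circ}{x}_i=-\sigma^2(\eta)e^{-p_i}\prod_{j\neq i}\frac{\sigma(x_i-x_j-\eta)}{\sigma(x_i-x_j)} .$$ Assume that $(x,p)$ is a turning point of the elliptic Ruijsenaars–Schneider model: $\dot x_i+\overset{\circ}{x}_i=0$ for all $i$ and, the sign of $\dot x_i$ being fixed accordingly, $\dot x_i=\sigma(\eta)\prod_{k\ne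 i}r_{ik}$, where $r_{ik}=r_{ki}$ is a square root of $$\frac{\sigma(x_i-x_k+\eta)\,\sigma(x_i-x_k-\eta)}{\sigma^2(x_i-x_k)}=\sigma^2(\eta)\bigl(\wp(\eta)-\wp(x_i-x_k)\bigr).$$ Let $L(\lambda)$ be the $N\times N$ Lax matrix $$L_{ij}(\lambda)=e^{-(x_i-x_j)\zeta(\lambda)}\,\dot x_i\,\frac{\sigma(x_i-x_j-\eta+\lambda)}{\sigma(\lambda)\,\sigma(x_i-x_j-\eta)} .$$ The function $\sigma(\lambda)\det(zI-L(\lambda))$ extends to an entire function $F(z,\lambda)$ on $\mathbb C^2$, of degree $N$ in $z$ with leading coefficient $\sigma(\lambda)$. Let $\tilde\Gamma\subset\mathbb P^1\times\mathbb C$ be the curve $F(z,\lambda)=0$ (read in homogeneous coordinates at $z=\infty$), and assume that it is nonsingular, i.e. $dF\ne0$ at all points of $\tilde\Gamma$ with $z\neq\infty$ (at $z=\infty$ this is automatic). The spectral curve $\Gamma$ is the quotient of $\tilde\Gamma$ by the group generated by $(z,\lambda)\mapsto(e^{-2\zeta(\omega_\alpha)\eta}z,\ \lambda+2\omega_\alpha)$,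 $\alpha=1,2$. Then $\iota:(z,\lambda)\mapsto(z^{-1},N\eta-\lambda)$ maps $\Gamma$ to itself, and: - if $N$ is even, $\iota$ has exactly $2$ fixed points on $\Gamma$, namely the classes of $(1,\tfrac12N\eta)$ and $(-1,\tfrac12N\eta)$; - if $N$ is odd, $\iota$ has exactly $4$ fixed points on $\Gamma$, namely the classes of $(1,\tfrac12N\eta)$ and of $(-e^{\zeta(\omega)\eta},\tfrac12N\eta-\omega)$ for the three half-periods $\omega=\omega_1,\ \omega_2,\ \omega_1+\omega_2$. -/

import Mathlib

open Filter Topology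

noncomputable section

namespace RuijsenaarsSchneider

/-- The lattice of quasi-periods `2 m₁ ω₁ + 2 m₂ ω₂` with integers `m₁, m₂`. -/
def periodLattice (ω₁ ω₂ : ℂ) : Submodule ℤ ℂ :=
  Submodule.span ℤ {2 * ω₁, 2 * ω₂}

/-- The Weierstrass sigma function `x ∏_{s ≠ 0} (1 - x/s) exp (x/s + x²/(2s²))`, the product
being over the nonzero elements `s` of the lattice. -/
def sigma (ω₁ ω₂ x : ℂ) : ℂ :=
  x * ∏' s : {s : ℂ // s ∈ periodLattice ω₁ ω₂ ∧ s ≠ 0},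
    (1 - x / s) * Complex.exp (x / s + x ^ 2 / (2 * (s : ℂ) ^ 2))

/-- The Weierstrass zeta function `σ' / σ`. -/
def zeta (ω₁ ω₂ x : ℂ) : ℂ :=
  deriv (sigma ω₁ ω₂) x / sigma ω₁ ω₂ x

/-- The velocity `∂H₁/∂pᵢ` of the `i`-th particle in the flow with Hamiltonian
`H₁ = ∑ᵢ exp pᵢ ∏_{j ≠ i} σ(xᵢ - xⱼ + η) / σ(xᵢ - xⱼ)`. -/
def velocity (ω₁ ω₂ η : ℂ) {N : ℕ} (x p : Fin N → ℂ) (i : Fin N) : ℂ :=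
  Complex.exp (p i) * ∏ j ∈ Finset.univ.erase i,
    sigma ω₁ ω₂ (x i - x j + η) / sigma ω₁ ω₂ (x i - x j)

/-- The velocity `∂H̄₁/∂pᵢ` of the `i`-th particle in the flow with Hamiltonian
`H̄₁ = σ(η)² ∑ᵢ exp (-pᵢ) ∏_{j ≠ i} σ(xᵢ - xⱼ - η) / σ(xᵢ - xⱼ)`. -/
def velocityBar (ω₁ ω₂ η : ℂ) {N : ℕ} (x p : Fin N → ℂ) (i : Fin N) : ℂ :=
  -(sigma ω₁ ω₂ η) ^ 2 * Complex.exp (-p i) * ∏ j ∈ Finset.univ.erase i,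
    sigma ω₁ ω₂ (x i - x j - η) / sigma ω₁ ω₂ (x i - x j)

/-- Turning points: all the velocities of the flow with Hamiltonian `H₁ + H̄₁` vanish, and
`∂H₁/∂pᵢ = σ(η) ∏_{k ≠ i} r i k`, where `r i k` is a square root of
`σ(xᵢ - xₖ + η) σ(xᵢ - xₖ - η) / σ(xᵢ - xₖ)² = σ(η)² (℘(η) - ℘(xᵢ - xₖ))`. This quantity is
even in `xᵢ - xₖ`, and one root is chosen for each pair `{i, k}`. (Up to the signs of the
velocities the second condition follows from the first one.) -/
def IsTurningPoint (ω₁ ω₂ η : ℂ) {N : ℕ} (x p : Fin N → ℂ) : Prop :=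
  (∀ i, velocity ω₁ ω₂ η x p i + velocityBar ω₁ ω₂ η x p i = 0) ∧
  ∃ r : Fin N → Fin N → ℂ,
    (∀ i k, r i k = r k i) ∧
    (∀ i k, i ≠ k → r i k ^ 2 =
      sigma ω₁ ω₂ (x i - x k + η) * sigma ω₁ ω₂ (x i - x k - η) /
        sigma ω₁ ω₂ (x i - x k) ^ 2) ∧
    ∀ i, velocity ω₁ ω₂ η x p i = sigma ω₁ ω₂ η * ∏ k ∈ Finset.univ.erase i, r i k

/-- The Lax matrix, meaningful for spectral parameters `l` outside the lattice. -/
def laxMatrix (ω₁ ω₂ η : ℂ) {N : ℕ} (x p : Fin N → ℂ) (l : ℂ) : Matrix (Fin N) (Fin N) ℂ :=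
  Matrix.of fun i j =>
    Complex.exp (-(x i - x j) * zeta ω₁ ω₂ l) * velocity ω₁ ω₂ η x p i *
      (sigma ω₁ ω₂ (x i - x j - η + l) / (sigma ω₁ ω₂ l * sigma ω₁ ω₂ (x i - x j - η)))

/-- The entire function of `l` that equals `σ(l) det (u I - v L(l))` outside the lattice. The
determinant has at most simple poles at the lattice points, so that the limit exists for every
`l`, and it is the value of the function itself when `l` is not in the lattice. -/
def curveFun (ω₁ ω₂ η : ℂ) {N : ℕ} (x p : Fin N → ℂ) (u v l : ℂ) : ℂ :=
  limUnder (𝓝[≠] l) fun m : ℂ =>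
    sigma ω₁ ω₂ m *
      (u • (1 : Matrix (Fin N) (Fin N) ℂ) - v • laxMatrix ω₁ ω₂ η x p m).det

/-- The curve of the points `(z, l)`, with `z` in the Riemann sphere, such that
`det (z I - L(l)) = 0`. Over the lattice points `l` it is given by the analytic continuation
`σ(l) det (z I - L(l)) = 0` of the equation, and points with `z = ∞` by this equation in
homogeneous coordinates. -/
def coveringCurve (ω₁ ω₂ η : ℂ) {N : ℕ} (x p : Fin N → ℂ) : Set (OnePoint ℂ × ℂ) :=
  {P | (∃ z : ℂ, P.1 = (z : OnePoint ℂ) ∧ curveFun ω₁ ω₂ η x p z 1 P.2 = 0) ∨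
    (P.1 = OnePoint.infty ∧ curveFun ω₁ ω₂ η x p 1 0 P.2 = 0)}

/-- The curve has no singular point: the differential of its equation does not vanish at any of
its points with `z ≠ ∞`. (In the coordinate `1 / z` the restriction of the equation to
`1 / z = 0` is `σ(l) = 0`, which has only simple zeros, so that no point with `z = ∞` is ever
singular.) -/
def IsNonsingular (ω₁ ω₂ η : ℂ) {N : ℕ} (x p : Fin N → ℂ) : Prop :=
  ∀ z l : ℂ, curveFun ω₁ ω₂ η x p z 1 l = 0 →
    fderiv ℂ (fun q : ℂ × ℂ => curveFun ω₁ ω₂ η x p q.1 1 q.2) (z, l) ≠ 0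

/-- Multiplication of `z` by `exp (-2 (m ζ(ω₁) + n ζ(ω₂)) η)`, with `∞` fixed. -/
def twist (ω₁ ω₂ η : ℂ) (m n : ℤ) : OnePoint ℂ → OnePoint ℂ :=
  OnePoint.map fun z =>
    Complex.exp (-2 * (m * zeta ω₁ ω₂ ω₁ + n * zeta ω₁ ω₂ ω₂) * η) * z

/-- The map `z ↦ 1 / z` of the Riemann sphere. -/
def recip (z : OnePoint ℂ) : OnePoint ℂ :=
  OnePoint.elim z ((0 : ℂ) : OnePoint ℂ)
    (fun w : ℂ => if w = 0 then OnePoint.infty else ((w⁻¹ : ℂ) : OnePoint ℂ))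

theorem twist_zero (ω₁ ω₂ η : ℂ) (z : OnePoint ℂ) : twist ω₁ ω₂ η 0 0 z = z := by
  induction z using OnePoint.rec <;> simp [twist]

theorem twist_add (ω₁ ω₂ η : ℂ) (m n m' n' : ℤ) (z : OnePoint ℂ) :
    twist ω₁ ω₂ η m n (twist ω₁ ω₂ η m' n' z) = twist ω₁ ω₂ η (m + m') (n + n') z := by
  induction z using OnePoint.rec with
  | infty => simp [twist]
  | coe z =>
    simp only [twist, OnePoint.map_some, ← mul_assoc, ← Complex.exp_add]
    push_cast
    congr 3
    ring

theorem recip_twist (ω₁ ω₂ η : ℂ) (m n : ℤ) (z : OnePoint ℂ) :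
    recip (twist ω₁ ω₂ η m n z) = twist ω₁ ω₂ η (-m) (-n) (recip z) := by
  induction z using OnePoint.rec with
  | infty => simp [twist, recip]
  | coe z =>
    by_cases hz : z = 0
    · simp [twist, recip, hz]
    · simp only [twist, recip, OnePoint.map_some, OnePoint.elim_some, mul_eq_zero,
        Complex.exp_ne_zero, hz, or_self, if_false, mul_inv, ← Complex.exp_neg]
      push_cast
      congr 3
      ring

/-- Equivalence modulo the group generated by the transformations
`l ↦ l + 2 ω_α`, `z ↦ exp (-2 ζ(ω_α) η) z` for `α = 1, 2`. -/
def deckSetoid (ω₁ ω₂ η : ℂ) : Setoid (OnePoint ℂ × ℂ) where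
  r P Q := ∃ m n : ℤ,
    Q.2 = P.2 + 2 * m * ω₁ + 2 * n * ω₂ ∧ Q.1 = twist ω₁ ω₂ η m n P.1
  iseqv :=
    { refl := fun P => ⟨0, 0, by simp, (twist_zero _ _ _ _).symm⟩
      symm := by
        rintro P Q ⟨m, n, h2, h1⟩
        refine ⟨-m, -n, ?_, ?_⟩
        · rw [h2]; push_cast; ring
        · rw [h1, twist_add]; simp [twist_zero]
      trans := by
        rintro P Q R ⟨m, n, h2, h1⟩ ⟨m', n', k2, k1⟩
        refine ⟨m' + m, n' + n, ?_, ?_⟩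
        · rw [k2, h2]; push_cast; ring
        · rw [k1, h1, twist_add] }

/-- The ambient surface of the spectral curve: the pairs `(z, l)` modulo these
transformations. -/
def Ambient (ω₁ ω₂ η : ℂ) : Type :=
  Quotient (deckSetoid ω₁ ω₂ η)

/-- The class of a pair `(z, l)`. -/
def toAmbient (ω₁ ω₂ η : ℂ) (P : OnePoint ℂ × ℂ) : Ambient ω₁ ω₂ η :=
  Quotient.mk (deckSetoid ω₁ ω₂ η) P

/-- The class of a pair `(z, l)` with `z ≠ ∞`. -/
def point (ω₁ ω₂ η z l : ℂ) : Ambient ω₁ ω₂ η :=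
  toAmbient ω₁ ω₂ η ((z : OnePoint ℂ), l)

/-- The spectral curve `Γ`. -/
def spectralCurve (ω₁ ω₂ η : ℂ) {N : ℕ} (x p : Fin N → ℂ) : Set (Ambient ω₁ ω₂ η) :=
  toAmbient ω₁ ω₂ η '' coveringCurve ω₁ ω₂ η x p

/-- The map `(z, l) ↦ (1 / z, N η - l)`. -/
def iota (ω₁ ω₂ η : ℂ) (N : ℕ) : Ambient ω₁ ω₂ η → Ambient ω₁ ω₂ η :=
  Quotient.map (fun P : OnePoint ℂ × ℂ => (recip P.1, N * η - P.2)) (by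
    rintro P Q ⟨m, n, h2, h1⟩
    refine ⟨-m, -n, ?_, ?_⟩
    · simp only [h2]; push_cast; ring
    · simp only [h1, recip_twist])

end RuijsenaarsSchneider

end

/-! The entire function σ(λ) det(uI − vL(λ)) can be computed explicitly. Expand it in principal
minors: the exponentials in L are a diagonal conjugation, the velocities are row factors, and
Frobenius' elliptic Cauchy determinant evaluates what remains. At a turning point each velocity is
σ(η) times a product of symmetric roots r_ik. The factors with both indices in a set s cancel
against the Frobenius denominators, leaving (`curveFun_eq_spectralFun`) F(u, v, λ) = ∑_s u^(N−|s|)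
v^|s| (∏_{i∈s, j∉s} r_ij) σ(λ − |s|η).

Three symmetries can be read off. F is homogeneous in (u, v); passing to complements, with σ odd and
r symmetric, gives F(v, u, Nη − λ) = −F(u, v, λ), which is ι; and the quasi-periodicity of σ gives
the deck transformations.

On the ambient surface ι fixes exactly the classes of (εe^{Zη}, Nη/2 − ω) with ε = ±1, where ω = aω₁
+ bω₂ and Z = aζ(ω₁) + bζ(ω₂) for a, b ∈ {0, 1}. Near such a point the symmetries combine to F = H ·
(F ∘ T), where T is a lift of ι fixing the point with differential −1. There H takes the value
−sε^N, with s = 1 for ω = 0 and s = −1 otherwise. If the value is −1, then F = −F, so the point lies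
on the curve. If it is +1 and the point lay on the curve, then dF = −dF = 0, against nonsingularity
(`spectralFun_eq_zero_iff`). So the fixed points on Γ are those with sε^N = 1: for N even, ω = 0 and
either ε; for N odd, exactly one ε = s for each of the four ω. -/

noncomputable section

/-! ### The Weierstrass σ function: convergence, zeros, parity -/

namespace PeriodPair

variable (L : PeriodPair)

/-- The primary factor `(1 - x / s) exp (x / s + x² / (2 s²))` of the Weierstrass `σ` function. -/
def sigmaFactor (s : {s : ℂ // s ∈ L.lattice ∧ s ≠ 0}) (x : ℂ) : ℂ :=
  (1 - x / s) * Complex.exp (x / s + x ^ 2 / (2 * (s : ℂ) ^ 2))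

/-- The product of the primary factors over the nonzero lattice points. -/
def sigmaProd (x : ℂ) : ℂ := ∏' s, L.sigmaFactor s x

/-- The Weierstrass `σ` function of a lattice. -/
def weierstrassSigma (x : ℂ) : ℂ := x * L.sigmaProd x

/-- The derivative of the primary factor is −v² exp(v + v²/2), so the mean value inequality on the
disc of radius |u| gives a cubic bound. The exponent 2 is a convenient bound for |v| + |v|²/2 when
|v| ≤ 1. -/
lemma norm_primaryFactor_sub_one_le {u : ℂ} (hu : ‖u‖ ≤ 1) :
    ‖(1 - u) * Complex.exp (u + u ^ 2 / 2) - 1‖ ≤ Real.exp 2 * ‖u‖ ^ 3 := by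
  have hd : ∀ v : ℂ, HasDerivAt (fun v : ℂ => (1 - v) * Complex.exp (v + v ^ 2 / 2))
      (-v ^ 2 * Complex.exp (v + v ^ 2 / 2)) v := by
    intro v
    have h1 : HasDerivAt (fun v : ℂ => v + v ^ 2 / 2) (1 + v) v := by
      have := (hasDerivAt_id v).add (((hasDerivAt_id v).pow 2).div_const 2)
      convert! this using 1
      simp
    have h2 := ((hasDerivAt_id v).const_sub 1).mul h1.cexp
    convert! h2 using 1
    simp only [id]
    ring
  have key := (convex_closedBall (0 : ℂ) ‖u‖).norm_image_sub_le_of_norm_hasDerivWithin_le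
    (f := fun v : ℂ => (1 - v) * Complex.exp (v + v ^ 2 / 2)) (C := ‖u‖ ^ 2 * Real.exp 2)
    (x := 0) (y := u) (fun v _ => (hd v).hasDerivWithinAt) ?_ (by simp) (by simp)
  · simp only [sub_zero, ne_eq, OfNat.ofNat_ne_zero, not_false_eq_true, zero_pow, zero_div,
      add_zero, Complex.exp_zero, mul_one] at key
    calc _ ≤ _ := key
      _ = _ := by ring
  · intro v hv
    have hv : ‖v‖ ≤ ‖u‖ := by simpa using hv
    have hv1 : ‖v‖ ≤ 1 := hv.trans hu
    rw [norm_mul, norm_neg, norm_pow]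
    gcongr
    refine (Complex.norm_exp_le_exp_norm _).trans (Real.exp_le_exp.mpr ?_)
    refine (norm_add_le _ _).trans ?_
    rw [norm_div, norm_pow]
    simp only [Complex.norm_ofNat]
    nlinarith [norm_nonneg v]

lemma summable_norm_nonzero_lattice :
    Summable fun s : {s : ℂ // s ∈ L.lattice ∧ s ≠ 0} => (‖(s : ℂ)‖ ^ 3)⁻¹ := by
  have h := ZLattice.summable_norm_pow_inv L.lattice 3 (by simp)
  have hinj : Function.Injective
      (fun s : {s : ℂ // s ∈ L.lattice ∧ s ≠ 0} => (⟨s.1, s.2.1⟩ : L.lattice)) := by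
    intro a b hab
    simpa [Subtype.ext_iff] using hab
  simpa [Function.comp_def] using h.comp_injective hinj

lemma eventually_le_norm_nonzero_lattice (r : ℝ) :
    ∀ᶠ s : {s : ℂ // s ∈ L.lattice ∧ s ≠ 0} in cofinite, r ≤ ‖(s : ℂ)‖ := by
  have h := L.summable_norm_nonzero_lattice.tendsto_cofinite_zero
  have h2 : ∀ᶠ s : {s : ℂ // s ∈ L.lattice ∧ s ≠ 0} in cofinite,
      (‖(s : ℂ)‖ ^ 3)⁻¹ < ((|r| + 1) ^ 3)⁻¹ :=
    h.eventually (gt_mem_nhds (by positivity))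
  filter_upwards [h2] with s hs
  have hs0 : 0 < ‖(s : ℂ)‖ := norm_pos_iff.mpr s.2.2
  have h3 := (inv_lt_inv₀ (by positivity) (by positivity)).mp hs
  have h4 := lt_of_pow_lt_pow_left₀ 3 hs0.le h3
  linarith [le_abs_self r]

lemma norm_sigmaFactor_sub_one_le {r : ℝ} {s : {s : ℂ // s ∈ L.lattice ∧ s ≠ 0}}
    (hs : r ≤ ‖(s : ℂ)‖) {x : ℂ} (hx : ‖x‖ ≤ r) :
    ‖L.sigmaFactor s x - 1‖ ≤ Real.exp 2 * r ^ 3 * (‖(s : ℂ)‖ ^ 3)⁻¹ := by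
  have hs0 : 0 < ‖(s : ℂ)‖ := norm_pos_iff.mpr s.2.2
  have h1 : ‖x / s‖ ≤ 1 := by
    rw [norm_div]
    exact (div_le_one hs0).mpr (hx.trans hs)
  have h2 := norm_primaryFactor_sub_one_le h1
  have h3 : L.sigmaFactor s x = (1 - x / s) * Complex.exp (x / s + (x / s) ^ 2 / 2) := by
    rw [sigmaFactor]
    congr 3
    rw [div_pow, div_div, mul_comm]
  rw [h3]
  refine h2.trans ?_
  rw [norm_div, div_pow, mul_assoc, ← div_eq_mul_inv]
  gcongr

lemma differentiable_sigmaFactor (s : {s : ℂ // s ∈ L.lattice ∧ s ≠ 0}) :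
    Differentiable ℂ (L.sigmaFactor s) := by
  unfold sigmaFactor
  fun_prop

/-- The cubic bound is summable over a lattice in the plane. It applies only to lattice points of
norm at least r, that is, to all but finitely many, which suffices on a fixed ball. -/
lemma hasProdLocallyUniformlyOn_sigmaFactor (r : ℝ) :
    HasProdLocallyUniformlyOn L.sigmaFactor L.sigmaProd (Metric.ball 0 r) := by
  have h := Summable.hasProdLocallyUniformlyOn_one_add (K := Metric.ball (0 : ℂ) r)
    (f := fun (s : {s : ℂ // s ∈ L.lattice ∧ s ≠ 0}) x => L.sigmaFactor s x - 1)
    (u := fun s : {s : ℂ // s ∈ L.lattice ∧ s ≠ 0} =>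
      Real.exp 2 * r ^ 3 * (‖(s : ℂ)‖ ^ 3)⁻¹) Metric.isOpen_ball
    (L.summable_norm_nonzero_lattice.mul_left _) ?_
    (fun s => ((L.differentiable_sigmaFactor s).continuous.sub continuous_const).continuousOn)
  · simp only [add_sub_cancel] at h
    exact h
  · filter_upwards [L.eventually_le_norm_nonzero_lattice r] with s hs x hx
    exact L.norm_sigmaFactor_sub_one_le hs (by simpa using (Metric.mem_ball.mp hx).le)

lemma differentiable_sigmaProd : Differentiable ℂ L.sigmaProd := by
  intro x
  have h := (L.hasProdLocallyUniformlyOn_sigmaFactor (‖x‖ + 1)).differentiableOn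
    (.of_forall fun t => by
      simpa [Finset.prod_fn] using
        DifferentiableOn.finsetProd (fun s _ => (L.differentiable_sigmaFactor s).differentiableOn))
    Metric.isOpen_ball
  exact (h x (by simp)).differentiableAt (Metric.isOpen_ball.mem_nhds (by simp))

@[fun_prop]
lemma differentiable_weierstrassSigma : Differentiable ℂ L.weierstrassSigma :=
  differentiable_id.mul L.differentiable_sigmaProd

lemma sigmaFactor_eq_zero_iff {s : {s : ℂ // s ∈ L.lattice ∧ s ≠ 0}} {x : ℂ} :
    L.sigmaFactor s x = 0 ↔ x = s := by
  have := s.2.2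
  rw [sigmaFactor, mul_eq_zero, or_iff_left (Complex.exp_ne_zero _), sub_eq_zero, eq_comm,
    div_eq_one_iff_eq this]

lemma summable_norm_sigmaFactor_sub_one (x : ℂ) :
    Summable fun s => ‖L.sigmaFactor s x - 1‖ := by
  refine Summable.of_norm_bounded_eventually
    (g := fun s => Real.exp 2 * ‖x‖ ^ 3 * (‖(s : ℂ)‖ ^ 3)⁻¹)
    (L.summable_norm_nonzero_lattice.mul_left _) ?_
  filter_upwards [L.eventually_le_norm_nonzero_lattice ‖x‖] with s hs
  rw [norm_norm]
  exact L.norm_sigmaFactor_sub_one_le hs le_rfl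

/-- An absolutely convergent product vanishes only where one of its factors does. -/
lemma sigmaProd_eq_zero_iff {x : ℂ} : L.sigmaProd x = 0 ↔ x ∈ L.lattice ∧ x ≠ 0 := by
  constructor
  · intro h
    by_contra hx
    refine tprod_one_add_ne_zero_of_summable (f := fun s => L.sigmaFactor s x - 1) ?_
      (L.summable_norm_sigmaFactor_sub_one x) (by simpa only [add_sub_cancel, sigmaProd] using h)
    intro s hs
    rw [add_sub_cancel, sigmaFactor_eq_zero_iff] at hs
    exact hx (hs ▸ s.2)
  · intro h
    exact tprod_of_exists_eq_zero ⟨⟨x, h⟩, L.sigmaFactor_eq_zero_iff.mpr rfl⟩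

lemma weierstrassSigma_eq_zero_iff {x : ℂ} : L.weierstrassSigma x = 0 ↔ x ∈ L.lattice := by
  rw [weierstrassSigma, mul_eq_zero, sigmaProd_eq_zero_iff]
  constructor
  · rintro (rfl | h)
    exacts [zero_mem _, h.1]
  · intro h
    by_cases hx : x = 0
    exacts [.inl hx, .inr ⟨h, hx⟩]

lemma sigmaProd_zero : L.sigmaProd 0 = 1 := by
  simp [sigmaProd, sigmaFactor]

lemma weierstrassSigma_zero : L.weierstrassSigma 0 = 0 := by simp [weierstrassSigma]

lemma deriv_weierstrassSigma_zero : deriv L.weierstrassSigma 0 = 1 := by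
  have h := (hasDerivAt_id (0 : ℂ)).mul (L.differentiable_sigmaProd 0).hasDerivAt
  have h2 := h.deriv
  simp only [sigmaProd_zero, id, zero_mul, add_zero, mul_one] at h2
  exact h2

lemma weierstrassSigma_neg (x : ℂ) : L.weierstrassSigma (-x) = -L.weierstrassSigma x := by
  have h : L.sigmaProd (-x) = L.sigmaProd x := by
    let e : {s : ℂ // s ∈ L.lattice ∧ s ≠ 0} ≃ {s : ℂ // s ∈ L.lattice ∧ s ≠ 0} :=
      (Equiv.neg ℂ).subtypeEquiv (by simp)
    rw [sigmaProd, sigmaProd, ← e.tprod_eq]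
    refine tprod_congr fun s => ?_
    simp [sigmaFactor, e]
  rw [weierstrassSigma, weierstrassSigma, h, neg_mul]

/-! ### The logarithmic derivative of σ and quasi-periodicity -/

/-- The sum `∑ (1 / (x - l) + 1 / l + x / l²)` over the lattice, the term of `l = 0` being
`1 / x`. -/
def zetaSum (x : ℂ) : ℂ := ∑' l : L.lattice, (1 / (x - l) + 1 / l + x / (l : ℂ) ^ 2)

/-- Over a common denominator the three fractions collapse to x² / ((x − l) l²), and |x − l| ≥ |l|/2
in this range. -/
lemma norm_zetaSum_term_le {r : ℝ} {x : ℂ} (hx : ‖x‖ < r) {l : ℂ} (hl : 2 * r ≤ ‖l‖) :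
    ‖1 / (x - l) + 1 / l + x / l ^ 2‖ ≤ 2 * r ^ 2 * (‖l‖ ^ 3)⁻¹ := by
  have hr : 0 < r := (norm_nonneg x).trans_lt hx
  have hl0 : 0 < ‖l‖ := by linarith
  have hne : l ≠ 0 := norm_pos_iff.mp hl0
  have hxl : ‖l‖ / 2 ≤ ‖x - l‖ := by
    rw [norm_sub_rev]
    exact le_trans (by linarith) (norm_sub_norm_le l x)
  have hxl0 : x - l ≠ 0 := norm_pos_iff.mp (lt_of_lt_of_le (by positivity) hxl)
  have h : 1 / (x - l) + 1 / l + x / l ^ 2 = x ^ 2 / ((x - l) * l ^ 2) := by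
    field_simp
    ring
  rw [h, norm_div, norm_mul, norm_pow, norm_pow]
  calc ‖x‖ ^ 2 / (‖x - l‖ * ‖l‖ ^ 2) ≤ r ^ 2 / (‖l‖ / 2 * ‖l‖ ^ 2) := by gcongr
    _ = 2 * r ^ 2 * (‖l‖ ^ 3)⁻¹ := by field_simp

lemma summable_norm_lattice_pow_inv :
    Summable fun l : L.lattice => (‖(l : ℂ)‖ ^ 3)⁻¹ := by
  simpa using ZLattice.summable_norm_pow_inv L.lattice 3 (by simp)

lemma hasSumLocallyUniformly_zetaSum :
    HasSumLocallyUniformly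
      (fun (l : L.lattice) (x : ℂ) => 1 / (x - l) + 1 / l + x / (l : ℂ) ^ 2) L.zetaSum := by
  refine L.hasSumLocallyUniformly_aux (u := fun r (l : L.lattice) => 2 * r ^ 2 * (‖(l : ℂ)‖ ^ 3)⁻¹) _
    (fun r _ => L.summable_norm_lattice_pow_inv.mul_left _) fun r hr =>
    Filter.eventually_atTop.mpr ⟨2 * r, ?_⟩
  rintro _ h x hx l rfl
  exact norm_zetaSum_term_le hx h

lemma hasDerivAt_zetaSum_term {x l : ℂ} (h : x ≠ l) :
    HasDerivAt (fun x : ℂ => 1 / (x - l) + 1 / l + x / l ^ 2)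
      (-(1 / (x - l) ^ 2 - 1 / l ^ 2)) x := by
  have h1 := (((hasDerivAt_id x).sub_const l).inv (sub_ne_zero.mpr h)).add_const (1 / l)
  have h2 := h1.add ((hasDerivAt_id x).div_const (l ^ 2))
  convert! h2 using 1
  · ext y; simp
  · simp only [id]
    ring

/-- Termwise differentiation under locally uniform convergence. Through it the periodicity of ℘
controls the translates of `zetaSum`. -/
lemma hasDerivAt_zetaSum {x : ℂ} (hx : x ∉ L.lattice) :
    HasDerivAt L.zetaSum (-℘[L] x) x := by
  have hopen : IsOpen (L.lattice : Set ℂ)ᶜ := L.isClosed_lattice.isOpen_compl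
  have hdiff : ∀ᶠ t : Finset L.lattice in atTop, DifferentiableOn ℂ
      (fun x : ℂ => ∑ l ∈ t, (1 / (x - l) + 1 / (l : ℂ) + x / (l : ℂ) ^ 2))
      (L.lattice : Set ℂ)ᶜ := by
    refine .of_forall fun t => .fun_sum fun l _ y hy => ?_
    exact (hasDerivAt_zetaSum_term (by rintro rfl; exact hy l.2)).differentiableAt
      |>.differentiableWithinAt
  have h := L.hasSumLocallyUniformly_zetaSum.tendstoLocallyUniformlyOn (s := (L.lattice : Set ℂ)ᶜ)
  have h1 := h.differentiableOn hdiff hopen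
  have h2 := (h.deriv hdiff hopen).tendsto_at hx
  have h3 : Tendsto (fun t : Finset L.lattice =>
      deriv (fun x : ℂ => ∑ l ∈ t, (1 / (x - l) + 1 / (l : ℂ) + x / (l : ℂ) ^ 2)) x)
      atTop (𝓝 (-℘[L] x)) := by
    refine (L.hasSum_weierstrassP x).neg.congr fun t => ?_
    refine (HasDerivAt.fun_sum fun l _ => ?_).deriv.symm
    exact hasDerivAt_zetaSum_term (by rintro rfl; exact hx l.2)
  have h4 := tendsto_nhds_unique h2 h3
  rw [← h4]
  exact (h1.differentiableAt (hopen.mem_nhds hx)).hasDerivAt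

lemma logDeriv_sigmaFactor {s : {s : ℂ // s ∈ L.lattice ∧ s ≠ 0}} {x : ℂ} (h : x ≠ s) :
    logDeriv (L.sigmaFactor s) x = 1 / (x - s) + 1 / s + x / (s : ℂ) ^ 2 := by
  have hs := s.2.2
  have h1 : HasDerivAt (fun x : ℂ => 1 - x / s) (-(1 / s)) x :=
    ((hasDerivAt_id x).div_const (s : ℂ)).const_sub 1
  have h2 : HasDerivAt (fun x : ℂ => x / s + x ^ 2 / (2 * (s : ℂ) ^ 2))
      (1 / s + 2 * x / (2 * (s : ℂ) ^ 2)) x := by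
    have := ((hasDerivAt_id x).div_const (s : ℂ)).add
      (((hasDerivAt_id x).pow 2).div_const (2 * (s : ℂ) ^ 2))
    convert! this using 1
    simp
  have h3 := (h1.mul h2.cexp).deriv
  have h4 : x - s ≠ 0 := sub_ne_zero.mpr h
  have h5 : (s : ℂ) - x ≠ 0 := sub_ne_zero.mpr h.symm
  have h6 : L.sigmaFactor s = (fun x : ℂ => 1 - x / s) *
    fun x => Complex.exp (x / s + x ^ 2 / (2 * (s : ℂ) ^ 2)) := rfl
  rw [logDeriv_apply, h6, h3, Pi.mul_apply]
  have h7 : (1 : ℂ) - x / s ≠ 0 := by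
    rw [one_sub_div hs]
    exact div_ne_zero h5 hs
  have hE := Complex.exp_ne_zero (x / s + x ^ 2 / (2 * (s : ℂ) ^ 2))
  generalize Complex.exp (x / s + x ^ 2 / (2 * (s : ℂ) ^ 2)) = E at *
  rw [show (1 / (x - s) : ℂ) = -(1 / s) / (1 - x / s) by field_simp; ring]
  field_simp
  ring

lemma logDeriv_weierstrassSigma {x : ℂ} (hx : x ∉ L.lattice) :
    logDeriv L.weierstrassSigma x = L.zetaSum x := by
  have hx0 : x ≠ 0 := by rintro rfl; exact hx (zero_mem _)
  have hP : L.sigmaProd x ≠ 0 := fun h => hx (L.sigmaProd_eq_zero_iff.mp h).1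
  have hne : ∀ s : {s : ℂ // s ∈ L.lattice ∧ s ≠ 0}, x ≠ s := by
    rintro s rfl
    exact hx s.2.1
  have hsum : HasSum (fun l : L.lattice => 1 / (x - l) + 1 / l + x / (l : ℂ) ^ 2) (L.zetaSum x) :=
    L.hasSumLocallyUniformly_zetaSum.hasSum
  let e : {l : L.lattice // l ≠ 0} ≃ {s : ℂ // s ∈ L.lattice ∧ s ≠ 0} :=
    { toFun := fun l => ⟨l.1.1, l.1.2, fun h => l.2 (Subtype.ext h)⟩
      invFun := fun s => ⟨⟨s.1, s.2.1⟩, fun h => s.2.2 (congrArg Subtype.val h)⟩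
      left_inv := fun _ => rfl
      right_inv := fun _ => rfl }
  have hsum1 : HasSum (fun s : {s : ℂ // s ∈ L.lattice ∧ s ≠ 0} =>
      1 / (x - s) + 1 / (s : ℂ) + x / (s : ℂ) ^ 2) (L.zetaSum x - 1 / x) := by
    rw [← e.hasSum_iff]
    have h := (hasSum_subtype_iff_indicator (s := {l : L.lattice | l ≠ 0})
      (f := fun l : L.lattice => 1 / (x - l) + 1 / l + x / (l : ℂ) ^ 2)
      (a := L.zetaSum x - 1 / x)).mpr ?_
    · exact h
    -- The term of l = 0 is 1/x because division by zero gives 0; it belongs to the factor x of σ,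
    -- not to the product.
    · have h0 := hasSum_ite_eq (0 : L.lattice) (1 / x)
      refine (hsum.sub h0).congr_fun fun l => ?_
      by_cases hl : l = 0
      · simp [hl]
      · simp [hl]
  have h1 := logDeriv_tprod_eq_tsum (s := Metric.ball 0 (‖x‖ + 1)) (x := x) (f := L.sigmaFactor)
    Metric.isOpen_ball (by simp) (fun s h => hne s (L.sigmaFactor_eq_zero_iff.mp h))
    (fun s => (L.differentiable_sigmaFactor s).differentiableOn)
    (by simpa only [L.logDeriv_sigmaFactor (hne _)] using hsum1.summable)
    ⟨_, L.hasProdLocallyUniformlyOn_sigmaFactor _⟩ hP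
  simp only [L.logDeriv_sigmaFactor (hne _), hsum1.tsum_eq] at h1
  have h2 : logDeriv (fun x => id x * L.sigmaProd x) x = _ :=
    logDeriv_mul x hx0 hP differentiableAt_id (L.differentiable_sigmaProd x)
  change logDeriv (fun x => id x * L.sigmaProd x) x = _
  change logDeriv L.sigmaProd x = _ at h1
  rw [h2, h1]
  simp [logDeriv_id]

lemma countable_lattice : (L.lattice : Set ℂ).Countable := by
  have : Countable L.lattice := L.latticeEquivProd.toEquiv.countable_iff.mpr inferInstance
  exact Set.to_countable _

lemma isPreconnected_compl_lattice : IsPreconnected (L.lattice : Set ℂ)ᶜ :=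
  (L.countable_lattice.isConnected_compl_of_one_lt_rank
    (by rw [Complex.rank_real_complex]; norm_num)).isPreconnected

lemma dense_compl_of_countable {s : Set ℂ} (hs : s.Countable) : Dense sᶜ :=
  hs.dense_compl ℝ

/-- Outside the lattice, the logarithmic derivative of `σ` changes by a constant under
translation by a period. -/
lemma exists_zetaSum_add {w : ℂ} (hw : w ∈ L.lattice) :
    ∃ c, ∀ x ∉ L.lattice, L.zetaSum (x + w) = L.zetaSum x + c := by
  have hadd : ∀ x ∉ L.lattice, x + w ∉ L.lattice := fun x hx h =>
    hx (by simpa using sub_mem h hw)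
  -- The derivative is −℘(x + w) + ℘(x) = 0, and the complement of the countable lattice is
  -- connected.
  have hd : ∀ x ∈ (L.lattice : Set ℂ)ᶜ,
      HasDerivAt (fun x => L.zetaSum (x + w) - L.zetaSum x) 0 x := by
    intro x hx
    have h1 := (L.hasDerivAt_zetaSum (hadd x hx)).comp_add_const x w
    have h2 := h1.sub (L.hasDerivAt_zetaSum hx)
    have h3 := L.weierstrassP_add_coe x ⟨w, hw⟩
    simp only at h3
    rw [h3, sub_self] at h2
    exact h2
  obtain ⟨c, hc⟩ := L.isClosed_lattice.isOpen_compl.exists_is_const_of_deriv_eq_zero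
    L.isPreconnected_compl_lattice (f := fun x => L.zetaSum (x + w) - L.zetaSum x)
    (fun x hx => (hd x hx).differentiableAt.differentiableWithinAt)
    (fun x hx => (hd x hx).deriv)
  exact ⟨c, fun x hx => by linear_combination hc x hx⟩

/-- `σ` is quasi-periodic. -/
lemma exists_weierstrassSigma_add {w c : ℂ} (hw : w ∈ L.lattice)
    (hc : ∀ x ∉ L.lattice, L.zetaSum (x + w) = L.zetaSum x + c) :
    ∃ C ≠ 0, ∀ x, L.weierstrassSigma (x + w) = C * Complex.exp (c * x) *
      L.weierstrassSigma x := by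
  have hadd : ∀ x ∉ L.lattice, x + w ∉ L.lattice := fun x hx h =>
    hx (by simpa using sub_mem h hw)
  have hσ : ∀ x ∉ L.lattice, L.weierstrassSigma x ≠ 0 := fun x hx h =>
    hx (L.weierstrassSigma_eq_zero_iff.mp h)
  have hderiv : ∀ x ∉ L.lattice,
      HasDerivAt L.weierstrassSigma (L.zetaSum x * L.weierstrassSigma x) x := by
    intro x hx
    have h := (L.differentiable_weierstrassSigma x).hasDerivAt
    rwa [← L.logDeriv_weierstrassSigma hx, logDeriv_apply, div_mul_cancel₀ _ (hσ x hx)]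
  have hd : ∀ x ∈ (L.lattice : Set ℂ)ᶜ, HasDerivAt (fun x => L.weierstrassSigma (x + w) *
      Complex.exp (-(c * x)) / L.weierstrassSigma x) 0 x := by
    intro x hx
    have h1 := (hderiv _ (hadd x hx)).comp_add_const x w
    have h2 : HasDerivAt (fun x : ℂ => -(c * x)) (-c) x := by
      simpa using ((hasDerivAt_id x).const_mul c).fun_neg
    have h3 := (h1.mul h2.cexp).div (hderiv x hx) (hσ x hx)
    convert! h3 using 1
    rw [hc x hx, Pi.mul_apply, eq_comm, div_eq_zero_iff]
    left
    ring
  obtain ⟨C, hC⟩ := L.isClosed_lattice.isOpen_compl.exists_is_const_of_deriv_eq_zero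
    L.isPreconnected_compl_lattice
    (fun x hx => (hd x hx).differentiableAt.differentiableWithinAt)
    (fun x hx => (hd x hx).deriv)
  suffices h : ∀ x, L.weierstrassSigma (x + w) = C * Complex.exp (c * x) *
      L.weierstrassSigma x by
    refine ⟨C, ?_, h⟩
    rintro rfl
    refine hσ _ (hadd _ L.ω₁_div_two_notMem_lattice) ?_
    rw [h, zero_mul, zero_mul]
  intro x
  by_cases hx : x ∈ L.lattice
  · rw [L.weierstrassSigma_eq_zero_iff.mpr hx, mul_zero, L.weierstrassSigma_eq_zero_iff]
    exact add_mem hx hw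
  · have h := hC x hx
    rw [div_eq_iff (hσ x hx)] at h
    calc L.weierstrassSigma (x + w) = L.weierstrassSigma (x + w) * Complex.exp (-(c * x)) *
          Complex.exp (c * x) := by
          rw [mul_assoc, ← Complex.exp_add, neg_add_cancel, Complex.exp_zero, mul_one]
      _ = _ := by rw [h]; ring

lemma deriv_weierstrassSigma_neg (x : ℂ) :
    deriv L.weierstrassSigma (-x) = deriv L.weierstrassSigma x := by
  have h : (fun x => L.weierstrassSigma (-x)) = fun x => -L.weierstrassSigma x :=
    funext L.weierstrassSigma_neg
  have h1 := deriv_comp_neg L.weierstrassSigma x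
  rw [h, deriv.fun_neg] at h1
  exact (neg_injective h1).symm

lemma zetaSum_neg {x : ℂ} (hx : x ∉ L.lattice) : L.zetaSum (-x) = -L.zetaSum x := by
  have hx' : -x ∉ L.lattice := by simpa using hx
  rw [← L.logDeriv_weierstrassSigma hx, ← L.logDeriv_weierstrassSigma hx', logDeriv_apply,
    logDeriv_apply, deriv_weierstrassSigma_neg, weierstrassSigma_neg, div_neg]

/-- The additive constant is read off at x = −ω, which translates to ω, since `zetaSum` is odd. -/
lemma zetaSum_add_two_mul {ω x : ℂ} (hω : ω ∉ L.lattice) (hω2 : 2 * ω ∈ L.lattice)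
    (hx : x ∉ L.lattice) : L.zetaSum (x + 2 * ω) = L.zetaSum x + 2 * L.zetaSum ω := by
  obtain ⟨c, hc⟩ := L.exists_zetaSum_add hω2
  have h := hc (-ω) (by simpa using hω)
  rw [L.zetaSum_neg hω, show -ω + 2 * ω = ω by ring] at h
  rw [hc x hx]
  linear_combination -h

/-- Translating −(ω + ω') by 2ω and then by 2ω' ends at ω + ω'; oddness does the rest. -/
lemma zetaSum_add_half_periods {ω ω' : ℂ} (hω : ω ∉ L.lattice) (hω2 : 2 * ω ∈ L.lattice)
    (hω' : ω' ∉ L.lattice) (hω2' : 2 * ω' ∈ L.lattice) (hs : ω + ω' ∉ L.lattice) :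
    L.zetaSum (ω + ω') = L.zetaSum ω + L.zetaSum ω' := by
  have hs' : -(ω + ω') ∉ L.lattice := neg_mem_iff.not.mpr hs
  have hs'' : -(ω + ω') + 2 * ω ∉ L.lattice := fun h => hs' (by
    simpa using sub_mem h hω2)
  have h1 := L.zetaSum_add_two_mul hω hω2 hs'
  have h2 := L.zetaSum_add_two_mul hω' hω2' hs''
  rw [h1, L.zetaSum_neg hs, show -(ω + ω') + 2 * ω + 2 * ω' = ω + ω' by ring] at h2
  linear_combination h2 / 2

/-- The multiplier is determined at x = −ω, where σ is odd and does not vanish; this is the source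
of the sign −1. -/
lemma weierstrassSigma_add_two_mul {ω : ℂ} (hω : ω ∉ L.lattice) (hω2 : 2 * ω ∈ L.lattice)
    (x : ℂ) : L.weierstrassSigma (x + 2 * ω) =
      -Complex.exp (2 * L.zetaSum ω * (x + ω)) * L.weierstrassSigma x := by
  obtain ⟨C, -, hC⟩ := L.exists_weierstrassSigma_add hω2
    (fun x hx => L.zetaSum_add_two_mul hω hω2 hx)
  have h := hC (-ω)
  have hσ : L.weierstrassSigma ω ≠ 0 := fun h => hω (L.weierstrassSigma_eq_zero_iff.mp h)
  rw [show -ω + 2 * ω = ω by ring, L.weierstrassSigma_neg] at h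
  have h1 : C * Complex.exp (2 * L.zetaSum ω * -ω) = -1 :=
    mul_right_cancel₀ hσ (by linear_combination h)
  have h2 : C = -Complex.exp (2 * L.zetaSum ω * ω) := by
    calc C = C * Complex.exp (2 * L.zetaSum ω * -ω) * Complex.exp (2 * L.zetaSum ω * ω) := by
          rw [mul_assoc, ← Complex.exp_add, mul_neg, neg_add_cancel, Complex.exp_zero, mul_one]
      _ = _ := by rw [h1]; ring
  rw [hC, h2, mul_add, Complex.exp_add]
  ring

/-- Quasi-periodicity carries the simple zero at 0 to every lattice point. -/
lemma deriv_weierstrassSigma_ne_zero {w : ℂ} (hw : w ∈ L.lattice) :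
    deriv L.weierstrassSigma w ≠ 0 := by
  obtain ⟨c, hc⟩ := L.exists_zetaSum_add hw
  obtain ⟨C, hC0, hC⟩ := L.exists_weierstrassSigma_add hw hc
  have h1 : deriv (fun x => L.weierstrassSigma (x + w)) 0 = deriv L.weierstrassSigma w := by
    rw [deriv_comp_add_const, zero_add]
  have h2 : HasDerivAt (fun x => C * Complex.exp (c * x)) (C * (Complex.exp (c * 0) * c)) 0 := by
    simpa using (((hasDerivAt_id (0 : ℂ)).const_mul c).cexp).const_mul C
  have h3 := (h2.mul (L.differentiable_weierstrassSigma 0).hasDerivAt).deriv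
  rw [← h1, funext hC]
  rw [L.weierstrassSigma_zero, L.deriv_weierstrassSigma_zero] at h3
  simp only [mul_zero, Complex.exp_zero, mul_one, zero_add] at h3
  exact fun h => hC0 (h3.symm.trans h)

lemma eventually_sigma_ne_zero (x : ℂ) : ∀ᶠ y in 𝓝[≠] x, L.weierstrassSigma y ≠ 0 := by
  have h := L.compl_lattice_sdiff_singleton_mem_nhds x
  filter_upwards [nhdsWithin_le_nhds h, self_mem_nhdsWithin] with y hy hyx h0
  exact hy ⟨L.weierstrassSigma_eq_zero_iff.mp h0, hyx⟩

/-! ### The three-term identity -/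

/-- An entire function with the same multipliers as `g` that vanishes at all the zeros of `g`,
which are simple, is a multiple of `g`. -/
lemma exists_eq_const_mul {f g : ℂ → ℂ} (hf : Differentiable ℂ f) (hg : Differentiable ℂ g)
    (hquasi : ∀ w ∈ L.lattice, ∃ m : ℂ → ℂ, (∀ x, m x ≠ 0) ∧ (∀ x, f (x + w) = m x * f x) ∧
      ∀ x, g (x + w) = m x * g x)
    (hzero : ∀ x, g x = 0 → f x = 0 ∧ deriv g x ≠ 0) (hdense : Dense {x | g x ≠ 0}) :
    ∃ C, ∀ x, f x = C * g x := by
  classical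
  -- The quotient f / g with its removable singularities filled by the ratio of derivatives; it is
  -- entire and elliptic, hence constant by Liouville.
  set q : ℂ → ℂ := fun x => if g x = 0 then deriv f x / deriv g x else f x / g x with hq
  have hdiff : Differentiable ℂ q := by
    intro z
    by_cases hz : g z = 0
    · obtain ⟨hfz, hgz⟩ := hzero z hz
      have hdf : Differentiable ℂ (dslope f z) := by
        rw [← differentiableOn_univ] at hf ⊢
        exact (Complex.differentiableOn_dslope univ_mem).mpr hf
      have hdg : Differentiable ℂ (dslope g z) := by
        rw [← differentiableOn_univ] at hg ⊢
        exact (Complex.differentiableOn_dslope univ_mem).mpr hg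
      have hne : dslope g z z ≠ 0 := by rwa [dslope_same]
      have hev : q =ᶠ[𝓝 z] fun x => dslope f z x / dslope g z x := by
        filter_upwards [hdg.continuous.continuousAt.eventually_ne hne] with x hx
        by_cases hxz : x = z
        · subst hxz
          simp [hq, hz, dslope_same]
        · have hxz' : x - z ≠ 0 := sub_ne_zero.mpr hxz
          rw [dslope_of_ne _ hxz, slope_def_field, hz, sub_zero] at hx
          rw [dslope_of_ne f hxz, dslope_of_ne g hxz, slope_def_field, slope_def_field, hz, hfz,
            sub_zero, sub_zero]
          have hgx : g x ≠ 0 := fun h => hx (by rw [h, zero_div])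
          simp only [hq, if_neg hgx]
          field_simp
      exact ((hdf z).fun_div (hdg z) hne).congr_of_eventuallyEq hev
    · have hev : q =ᶠ[𝓝 z] fun x => f x / g x := by
        filter_upwards [hg.continuous.continuousAt.eventually_ne hz] with x hx
        simp [hq, hx]
      exact ((hf z).fun_div (hg z) hz).congr_of_eventuallyEq hev
  have hper : ∀ w ∈ L.lattice, ∀ x, q (x + w) = q x := by
    intro w hw
    obtain ⟨m, hm0, hmf, hmg⟩ := hquasi w hw
    refine congrFun (Continuous.ext_on hdense
      (hdiff.continuous.comp (continuous_add_const w)) hdiff.continuous fun x hx => ?_)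
    have hx : g x ≠ 0 := hx
    have hxw : g (x + w) ≠ 0 := by
      rw [hmg]
      exact mul_ne_zero (hm0 x) hx
    simp only [hq, if_neg hx, if_neg hxw, hmf, hmg]
    exact mul_div_mul_left _ _ (hm0 x)
  have hbdd : Bornology.IsBounded (Set.range q) := by
    have hK : IsCompact (closure (ZSpan.fundamentalDomain L.basis)) :=
      (ZSpan.fundamentalDomain_isBounded L.basis).isCompact_closure
    refine (hK.image hdiff.continuous).isBounded.subset ?_
    rintro _ ⟨x, rfl⟩
    refine ⟨ZSpan.fract L.basis x, subset_closure (ZSpan.fract_mem_fundamentalDomain _ x), ?_⟩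
    have hmem : ((ZSpan.floor L.basis x : Submodule.span ℤ (Set.range L.basis)) : ℂ) ∈
        L.lattice := by
      rw [L.lattice_eq_span_range_basis]
      exact (ZSpan.floor L.basis x).2
    have h := hper _ hmem (ZSpan.fract L.basis x)
    rw [← h, ZSpan.fract_apply, sub_add_cancel]
  refine ⟨q 0, fun x => ?_⟩
  by_cases hx : g x = 0
  · rw [(hzero x hx).1, hx, mul_zero]
  · rw [hdiff.apply_eq_apply_of_bounded hbdd 0 x]
    simp only [hq, if_neg hx]
    rw [div_mul_cancel₀ _ hx]

/-- The factors exp(cb) and exp(−cb) cancel, so one multiplier serves every b. Hence all terms of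
the three-term identity transform alike. -/
lemma exists_weierstrassSigma_add_mul_sub {w : ℂ} (hw : w ∈ L.lattice) :
    ∃ m : ℂ → ℂ, (∀ x, m x ≠ 0) ∧ ∀ b x,
      L.weierstrassSigma (x + w + b) * L.weierstrassSigma (x + w - b) =
        m x * (L.weierstrassSigma (x + b) * L.weierstrassSigma (x - b)) := by
  obtain ⟨c, hc⟩ := L.exists_zetaSum_add hw
  obtain ⟨C, hC0, hC⟩ := L.exists_weierstrassSigma_add hw hc
  refine ⟨fun x => C ^ 2 * Complex.exp (2 * c * x),
    fun x => mul_ne_zero (pow_ne_zero _ hC0) (Complex.exp_ne_zero _), fun b x => ?_⟩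
  simp only
  rw [show x + w + b = (x + b) + w by ring, show x + w - b = (x - b) + w by ring, hC, hC,
    show 2 * c * x = c * (x + b) + c * (x - b) by ring, Complex.exp_add]
  ring

/-- As a function of a, the left side has the multipliers of σ(a + b)σ(a − b) and vanishes at its
zeros ±b modulo periods, so it is a multiple of it; a = c gives the constant. The condition on 2b
makes the zeros simple, those on b ± c permit the division at a = c. -/
lemma weierstrassSigma_three_term_of_notMem {a b c d : ℂ} (hb : 2 * b ∉ L.lattice)
    (hbc : b + c ∉ L.lattice) (hbc' : b - c ∉ L.lattice) :
    L.weierstrassSigma (a + c) * L.weierstrassSigma (a - c) *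
        (L.weierstrassSigma (b + d) * L.weierstrassSigma (b - d)) -
      L.weierstrassSigma (a + d) * L.weierstrassSigma (a - d) *
        (L.weierstrassSigma (b + c) * L.weierstrassSigma (b - c)) =
      L.weierstrassSigma (c + d) * L.weierstrassSigma (c - d) *
        (L.weierstrassSigma (a + b) * L.weierstrassSigma (a - b)) := by
  set σ := L.weierstrassSigma with hσ
  have hd : Differentiable ℂ σ := L.differentiable_weierstrassSigma
  have hneg : ∀ x, σ (-x) = -σ x := L.weierstrassSigma_neg
  have hz : ∀ x, σ x = 0 ↔ x ∈ L.lattice := fun x => L.weierstrassSigma_eq_zero_iff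
  -- Vanishing propagates along lattice translates, so only a = b and a = −b need checking.
  have hvan : ∀ w ∈ L.lattice, ∀ x, σ (x + c) * σ (x - c) * (σ (b + d) * σ (b - d)) -
      σ (x + d) * σ (x - d) * (σ (b + c) * σ (b - c)) = 0 →
      σ (x + w + c) * σ (x + w - c) * (σ (b + d) * σ (b - d)) -
      σ (x + w + d) * σ (x + w - d) * (σ (b + c) * σ (b - c)) = 0 := by
    intro w hw x hx
    obtain ⟨m, hm0, hm⟩ := L.exists_weierstrassSigma_add_mul_sub hw
    rw [hm, hm]
    linear_combination m x * hx
  have hex := L.exists_eq_const_mul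
    (f := fun a => σ (a + c) * σ (a - c) * (σ (b + d) * σ (b - d)) -
      σ (a + d) * σ (a - d) * (σ (b + c) * σ (b - c)))
    (g := fun a => σ (a + b) * σ (a - b)) (by fun_prop) (by fun_prop) ?_ ?_ ?_
  · obtain ⟨C, hC⟩ := hex
    have h := hC c
    simp only [sub_self, (hz 0).mpr (zero_mem _), mul_zero, zero_mul, zero_sub] at h
    rw [add_comm c b, ← neg_sub b c, hneg] at h
    have h1 : C = σ (c + d) * σ (c - d) := by
      refine mul_right_cancel₀ (mul_ne_zero (mt (hz _).mp hbc) (mt (hz _).mp hbc')) ?_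
      linear_combination h
    rw [← h1]
    exact hC a
  · intro w hw
    obtain ⟨m, hm0, hm⟩ := L.exists_weierstrassSigma_add_mul_sub hw
    refine ⟨m, hm0, fun x => ?_, fun x => hm b x⟩
    rw [hm, hm]
    ring
  · intro x hx
    have hder : deriv (fun a => σ (a + b) * σ (a - b)) x =
        deriv σ (x + b) * σ (x - b) + σ (x + b) * deriv σ (x - b) := by
      have h1 := (hd (x + b)).hasDerivAt.comp_add_const x b
      have h2 := (hd (x - b)).hasDerivAt.comp_sub_const x b
      exact (h1.mul h2).deriv
    rw [hder]
    rcases mul_eq_zero.mp hx with h | h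
    · have hw := (hz _).mp h
      have hne : x - b ∉ L.lattice := fun h' => hb (by
        have := sub_mem hw h'
        rwa [show x + b - (x - b) = 2 * b by ring] at this)
      refine ⟨?_, ?_⟩
      · have := hvan _ hw (-b) (by
          rw [show -b + c = -(b - c) by ring, show -b - c = -(b + c) by ring,
            show -b + d = -(b - d) by ring, show -b - d = -(b + d) by ring]
          simp only [hneg]
          ring)
        rwa [show -b + (x + b) = x by ring] at this
      · rw [h, zero_mul, add_zero]
        exact mul_ne_zero (L.deriv_weierstrassSigma_ne_zero hw) (mt (hz _).mp hne)
    · have hw := (hz _).mp h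
      have hne : x + b ∉ L.lattice := fun h' => hb (by
        have := sub_mem h' hw
        rwa [show x + b - (x - b) = 2 * b by ring] at this)
      refine ⟨?_, ?_⟩
      · have := hvan _ hw b (by ring)
        rwa [show b + (x - b) = x by ring] at this
      · rw [h, mul_zero, zero_add]
        exact mul_ne_zero (mt (hz _).mp hne) (L.deriv_weierstrassSigma_ne_zero hw)
  · have hcount : ((fun x => x - b) '' L.lattice ∪ (fun x => x + b) '' L.lattice : Set ℂ).Countable :=
      (L.countable_lattice.image _).union (L.countable_lattice.image _)
    refine Dense.mono (fun x hx h => ?_) (dense_compl_of_countable hcount)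
    refine hx ?_
    rcases mul_eq_zero.mp h with h | h
    · exact .inl ⟨x + b, (hz _).mp h, by ring⟩
    · exact .inr ⟨x - b, (hz _).mp h, by ring⟩

/-- The three-term identity for the Weierstrass `σ` function. -/
lemma weierstrassSigma_three_term (a b c d : ℂ) :
    L.weierstrassSigma (a + c) * L.weierstrassSigma (a - c) *
        (L.weierstrassSigma (b + d) * L.weierstrassSigma (b - d)) -
      L.weierstrassSigma (a + d) * L.weierstrassSigma (a - d) *
        (L.weierstrassSigma (b + c) * L.weierstrassSigma (b - c)) =
      L.weierstrassSigma (c + d) * L.weierstrassSigma (c - d) *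
        (L.weierstrassSigma (a + b) * L.weierstrassSigma (a - b)) := by
  -- The excluded values of b form a countable set, and both sides are continuous in b.
  have hcount : ((fun x => x / 2) '' (L.lattice : Set ℂ) ∪ (fun x => x - c) '' L.lattice ∪
      (fun x => x + c) '' L.lattice : Set ℂ).Countable :=
    ((L.countable_lattice.image _).union (L.countable_lattice.image _)).union
      (L.countable_lattice.image _)
  have hσ := L.differentiable_weierstrassSigma.continuous
  refine congrFun (Continuous.ext_on (f := fun b => L.weierstrassSigma (a + c) *
      L.weierstrassSigma (a - c) * (L.weierstrassSigma (b + d) * L.weierstrassSigma (b - d)) -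
      L.weierstrassSigma (a + d) * L.weierstrassSigma (a - d) *
        (L.weierstrassSigma (b + c) * L.weierstrassSigma (b - c)))
    (g := fun b => L.weierstrassSigma (c + d) * L.weierstrassSigma (c - d) *
        (L.weierstrassSigma (a + b) * L.weierstrassSigma (a - b)))
    (dense_compl_of_countable hcount) (by fun_prop) (by fun_prop) fun b hb => ?_) b
  refine L.weierstrassSigma_three_term_of_notMem (fun h => hb (.inl (.inl ?_)))
    (fun h => hb (.inl (.inr ?_))) (fun h => hb (.inr ?_))
  exacts [⟨2 * b, h, by ring⟩, ⟨b + c, h, by ring⟩, ⟨b - c, h, by ring⟩]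

end PeriodPair

/-! ### Principal minors -/

namespace Matrix

variable {ι K : Type*} [DecidableEq ι] [Field K]

/-- The principal submatrix on a finite set of indices. -/
def principal (M : Matrix ι ι K) (s : Finset ι) : Matrix s s K :=
  M.submatrix Subtype.val Subtype.val

/-- Schur complement with pivot the entry (a, a), the induction step for Frobenius' determinant. -/
lemma det_principal_insert (M : Matrix ι ι K) {s : Finset ι} {a : ι} (ha : a ∉ s)
    (haa : M a a ≠ 0) :
    (M.principal (insert a s)).det = M a a *
      (principal (of fun i j => M i j - M i a * M a j / M a a) s).det := by
  let e : {i // i ∈ insert a s} ≃ {i // i ∈ s} ⊕ PUnit.{1} :=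
    (Finset.subtypeInsertEquivOption ha).trans (Equiv.optionEquivSumPUnit _)
  let A : Matrix s s K := M.principal s
  let B : Matrix s PUnit.{1} K := of fun i _ => M i a
  let C : Matrix PUnit.{1} s K := of fun _ j => M a j
  let D : Matrix PUnit.{1} PUnit.{1} K := diagonal fun _ => M a a
  have hblocks : (M.principal (insert a s)).submatrix e.symm e.symm = fromBlocks A B C D := by
    ext i j
    rcases i with i | i <;> rcases j with j | j <;> rfl
  let _ : Invertible D :=
    { invOf := diagonal fun _ => (M a a)⁻¹
      invOf_mul_self := by simp [D, haa]
      mul_invOf_self := by simp [D, haa] }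
  have hinv : ⅟D = diagonal fun _ => (M a a)⁻¹ := rfl
  rw [← det_submatrix_equiv_self e.symm, hblocks, det_fromBlocks₂₂, hinv]
  congr 1
  · simp [D]
  · congr 1
    ext i j
    simp only [sub_apply, mul_apply, principal, submatrix_apply, of_apply, A, B, C]
    simp [div_eq_mul_inv, mul_right_comm]

/-- Multilinearity in the rows: s records the rows taken from −vM, and the remaining rows of uI make
each summand block triangular. -/
lemma det_smul_one_sub_smul [Fintype ι] (M : Matrix ι ι K) (u v : K) :
    (u • (1 : Matrix ι ι K) - v • M).det =
      ∑ s : Finset ι, u ^ sᶜ.card * (-v) ^ s.card * (M.principal s).det := by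
  have h1 : u • (1 : Matrix ι ι K) - v • M = (-v • M) + u • (1 : Matrix ι ι K) := by
    rw [neg_smul]
    abel
  have h2 := (detRowAlternating (n := ι) (R := K)).toMultilinearMap.map_add_univ
    (fun i => (-v • M) i) (fun i => (u • (1 : Matrix ι ι K)) i)
  rw [h1]
  refine h2.trans (Finset.sum_congr rfl fun s _ => ?_)
  change det (of (s.piecewise (fun i => (-v • M) i) (fun i => (u • (1 : Matrix ι ι K)) i))) = _
  rw [twoBlockTriangular_det _ (fun i => i ∈ s)]
  · have h3 : toSquareBlockProp (of (s.piecewise (fun i => (-v • M) i)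
        (fun i => (u • (1 : Matrix ι ι K)) i))) (fun i => i ∈ s) = -v • M.principal s := by
      ext i j
      simp [toSquareBlockProp, principal]
    have h4 : toSquareBlockProp (of (s.piecewise (fun i => (-v • M) i)
        (fun i => (u • (1 : Matrix ι ι K)) i))) (fun i => ¬i ∈ s) =
        u • (1 : Matrix {i // ¬i ∈ s} {i // ¬i ∈ s} K) := by
      ext i j
      simp [toSquareBlockProp, Finset.piecewise_eq_of_notMem _ _ _ i.2, one_apply,
        Subtype.ext_iff]
    have h5 : Fintype.card {i // ¬i ∈ s} = sᶜ.card := by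
      rw [Fintype.card_subtype]
      congr 1
      ext i
      simp
    have h6 : (-v • M.principal s).det *
        (u • (1 : Matrix {i // ¬i ∈ s} {i // ¬i ∈ s} K)).det =
        u ^ sᶜ.card * (-v) ^ s.card * (M.principal s).det := by
      rw [det_smul, det_smul, det_one, mul_one, Fintype.card_coe, h5]
      ring
    rw [h3, h4]
    convert! h6
  · intro i hi j hj
    have hij : i ≠ j := by
      rintro rfl
      exact hi hj
    simp [Finset.piecewise_eq_of_notMem _ _ _ hi, hij]

end Matrix

/-! ### Frobenius' determinant -/

namespace PeriodPair

variable (L : PeriodPair)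

/-- The matrix `σ(xᵢ - xⱼ - η + l) / (σ(l) σ(xᵢ - xⱼ - η))`. -/
def frobeniusMatrix {ι : Type*} (x : ι → ℂ) (η l : ℂ) : Matrix ι ι ℂ :=
  Matrix.of fun i j => L.weierstrassSigma (x i - x j - η + l) /
    (L.weierstrassSigma l * L.weierstrassSigma (x i - x j - η))

/-- Square roots `r i k = r k i` of `σ(xᵢ - xₖ + η) σ(xᵢ - xₖ - η) / σ(xᵢ - xₖ)²`. -/
structure IsSqrtFamily {ι : Type*} (x : ι → ℂ) (η : ℂ) (r : ι → ι → ℂ) : Prop where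
  symm : ∀ i k, r i k = r k i
  sq : ∀ i k, i ≠ k → r i k ^ 2 =
    L.weierstrassSigma (x i - x k + η) * L.weierstrassSigma (x i - x k - η) /
      L.weierstrassSigma (x i - x k) ^ 2

variable {L} {ι : Type*} {x : ι → ℂ} {η : ℂ} {r : ι → ι → ℂ}

/-- By the three-term identity, elimination of the index a reproduces the same matrix at l − η, up
to row and column factors. -/
lemma frobeniusMatrix_schur (hη : L.weierstrassSigma η ≠ 0)
    (hxη : ∀ i j, i ≠ j → L.weierstrassSigma (x i - x j - η) ≠ 0) {l : ℂ}
    (hl : L.weierstrassSigma l ≠ 0) (hl' : L.weierstrassSigma (l - η) ≠ 0) {a i j : ι}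
    (hi : i ≠ a) (hj : j ≠ a) :
    L.frobeniusMatrix x η l i j - L.frobeniusMatrix x η l i a * L.frobeniusMatrix x η l a j /
        L.frobeniusMatrix x η l a a =
      L.weierstrassSigma (x i - x a) / L.weierstrassSigma (x i - x a - η) *
        (L.weierstrassSigma (x a - x j) / L.weierstrassSigma (x a - x j - η) *
          L.frobeniusMatrix x η (l - η) i j) := by
  have hη' : L.weierstrassSigma (-η) ≠ 0 := by rwa [weierstrassSigma_neg, neg_ne_zero]
  have hij : L.weierstrassSigma (x i - x j - η) ≠ 0 := by
    by_cases h : i = j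
    · rwa [h, sub_self, zero_sub]
    · exact hxη i j h
  have hia := hxη i a hi
  have haj := hxη a j hj.symm
  -- The arguments are half sums and half differences chosen to make the sums and differences in the
  -- identity the arguments of σ in the matrix entries.
  have key := L.weierstrassSigma_three_term (l - η + (x i - x j) / 2) ((x i - x j) / 2 - η)
    ((x i - x j) / 2) ((x i - x a - (x a - x j)) / 2)
  rw [show l - η + (x i - x j) / 2 + (x i - x j) / 2 = x i - x j - η + l by ring,
    show l - η + (x i - x j) / 2 - (x i - x j) / 2 = l - η by ring,
    show (x i - x j) / 2 - η + (x i - x a - (x a - x j)) / 2 = x i - x a - η by ring,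
    show (x i - x j) / 2 - η - (x i - x a - (x a - x j)) / 2 = x a - x j - η by ring,
    show l - η + (x i - x j) / 2 + (x i - x a - (x a - x j)) / 2 = x i - x a - η + l by ring,
    show l - η + (x i - x j) / 2 - (x i - x a - (x a - x j)) / 2 = x a - x j - η + l by ring,
    show (x i - x j) / 2 - η + (x i - x j) / 2 = x i - x j - η by ring,
    show (x i - x j) / 2 - η - (x i - x j) / 2 = -η by ring,
    show (x i - x j) / 2 + (x i - x a - (x a - x j)) / 2 = x i - x a by ring,
    show (x i - x j) / 2 - (x i - x a - (x a - x j)) / 2 = x a - x j by ring,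
    show l - η + (x i - x j) / 2 + ((x i - x j) / 2 - η) = x i - x j - η + (l - η) by ring,
    show l - η + (x i - x j) / 2 - ((x i - x j) / 2 - η) = l by ring] at key
  simp only [frobeniusMatrix, Matrix.of_apply, sub_self, zero_sub]
  rw [show -η + l = l - η by ring]
  generalize L.weierstrassSigma (x i - x j - η + (l - η)) = s1 at *
  generalize L.weierstrassSigma (x i - x j - η + l) = s2 at *
  generalize L.weierstrassSigma (x i - x a - η + l) = s3 at *
  generalize L.weierstrassSigma (x a - x j - η + l) = s4 at *
  generalize L.weierstrassSigma (x i - x j - η) = s5 at *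
  generalize L.weierstrassSigma (x i - x a - η) = s6 at *
  generalize L.weierstrassSigma (x a - x j - η) = s7 at *
  generalize L.weierstrassSigma (x i - x a) = s8 at *
  generalize L.weierstrassSigma (x a - x j) = s9 at *
  generalize L.weierstrassSigma (l - η) = s10 at *
  generalize L.weierstrassSigma l = s11 at *
  generalize L.weierstrassSigma (-η) = s12 at *
  field_simp
  linear_combination key

/-- The row and column factors of one index, left over from elimination of a, multiply to an inverse
square of a root because σ is odd. -/
lemma IsSqrtFamily.mul_inv_eq (hr : L.IsSqrtFamily x η r) {a i : ι} (hi : i ≠ a) :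
    L.weierstrassSigma (x i - x a) / L.weierstrassSigma (x i - x a - η) *
      (L.weierstrassSigma (x a - x i) / L.weierstrassSigma (x a - x i - η)) = (r a i ^ 2)⁻¹ := by
  rw [hr.symm a i, hr.sq i a hi, ← neg_sub (x i) (x a), weierstrassSigma_neg,
    show -(x i - x a) - η = -(x i - x a + η) by ring, weierstrassSigma_neg, neg_div_neg_eq,
    div_mul_div_comm, inv_div]
  ring

/-- Frobenius' elliptic analogue of the Cauchy determinant, for the principal minors. -/
lemma IsSqrtFamily.det_frobeniusMatrix [DecidableEq ι] (hr : L.IsSqrtFamily x η r)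
    (hη : L.weierstrassSigma η ≠ 0)
    (hx : ∀ i j, i ≠ j → L.weierstrassSigma (x i - x j) ≠ 0)
    (hxη : ∀ i j, i ≠ j → L.weierstrassSigma (x i - x j - η) ≠ 0) (s : Finset ι) (l : ℂ)
    (hl : ∀ m : ℕ, m ≤ s.card → L.weierstrassSigma (l - m * η) ≠ 0) :
    L.weierstrassSigma η ^ s.card * (∏ i ∈ s, ∏ j ∈ s.erase i, r i j) *
        ((L.frobeniusMatrix x η l).principal s).det =
      (-1) ^ s.card * L.weierstrassSigma (l - s.card * η) / L.weierstrassSigma l := by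
  induction s using Finset.induction_on generalizing l with
  | empty =>
    have h0 := hl 0 le_rfl
    simp only [Nat.cast_zero, zero_mul, sub_zero] at h0
    simp [h0]
  | insert a s ha ih =>
    rw [Finset.card_insert_of_notMem ha] at hl ⊢
    have h0 : L.weierstrassSigma l ≠ 0 := by simpa using hl 0 (Nat.zero_le _)
    have h1 : L.weierstrassSigma (l - η) ≠ 0 := by simpa using hl 1 (Nat.le_add_left 1 _)
    have hne : ∀ i ∈ s, i ≠ a := by
      rintro i hi rfl
      exact ha hi
    -- The pivots telescope: each contributes −σ(l − η) / (σ(l)σ(η)), and l moves to l − η at the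
    -- next step.
    have haa : L.frobeniusMatrix x η l a a =
        -(L.weierstrassSigma (l - η) / (L.weierstrassSigma l * L.weierstrassSigma η)) := by
      simp only [frobeniusMatrix, Matrix.of_apply, sub_self, zero_sub, weierstrassSigma_neg]
      rw [show -η + l = l - η by ring, mul_neg, div_neg]
    have haa0 : L.frobeniusMatrix x η l a a ≠ 0 := by
      rw [haa]
      exact neg_ne_zero.mpr (div_ne_zero h1 (mul_ne_zero h0 hη))
    have hschur : (Matrix.principal (Matrix.of fun i j => L.frobeniusMatrix x η l i j -
        L.frobeniusMatrix x η l i a * L.frobeniusMatrix x η l a j /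
          L.frobeniusMatrix x η l a a) s).det =
        (∏ i ∈ s, (r a i ^ 2)⁻¹) * ((L.frobeniusMatrix x η (l - η)).principal s).det := by
      have hmat : Matrix.principal (Matrix.of fun i j => L.frobeniusMatrix x η l i j -
          L.frobeniusMatrix x η l i a * L.frobeniusMatrix x η l a j /
            L.frobeniusMatrix x η l a a) s =
          Matrix.of fun i j : s => (fun i : s => L.weierstrassSigma (x i - x a) /
              L.weierstrassSigma (x i - x a - η)) i *
            (Matrix.of fun i j : s => (fun j : s => L.weierstrassSigma (x a - x j) /
              L.weierstrassSigma (x a - x j - η)) j *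
                (L.frobeniusMatrix x η (l - η)).principal s i j) i j := by
        ext i j
        exact frobeniusMatrix_schur hη hxη h0 h1 (hne i i.2) (hne j j.2)
      rw [hmat, Matrix.det_mul_column, Matrix.det_mul_row, ← mul_assoc, ← Finset.prod_mul_distrib,
        ← Finset.prod_coe_sort s fun i => (r a i ^ 2)⁻¹]
      congr 1
      exact Finset.prod_congr rfl fun i _ => hr.mul_inv_eq (hne i i.2)
    -- Each new pair {a, i} occurs in both orders, which by symmetry gives the square that cancels
    -- the Schur factor.
    have hprod : ∏ i ∈ insert a s, ∏ j ∈ (insert a s).erase i, r i j =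
        (∏ i ∈ s, r a i ^ 2) * ∏ i ∈ s, ∏ j ∈ s.erase i, r i j := by
      rw [Finset.prod_insert ha, Finset.erase_insert ha]
      have h2 : ∀ i ∈ s, ∏ j ∈ (insert a s).erase i, r i j = r a i * ∏ j ∈ s.erase i, r i j := by
        intro i hi
        rw [Finset.erase_insert_of_ne (hne i hi).symm, Finset.prod_insert (by simp [ha]),
          hr.symm i a]
      rw [Finset.prod_congr rfl h2, Finset.prod_mul_distrib, ← mul_assoc,
        ← Finset.prod_mul_distrib]
      simp only [pow_two]
    have hr0 : ∏ i ∈ s, r a i ^ 2 ≠ 0 := by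
      refine Finset.prod_ne_zero_iff.mpr fun i hi => ?_
      have h := hr.mul_inv_eq (hne i hi)
      rw [Ne, ← inv_eq_zero, ← h]
      have hi' := hne i hi
      exact mul_ne_zero (div_ne_zero (hx _ _ hi') (hxη _ _ hi'))
        (div_ne_zero (hx _ _ hi'.symm) (hxη _ _ hi'.symm))
    have ih := ih (l - η) fun m hm => by
      have := hl (m + 1) (by omega)
      rwa [show l - η - m * η = l - (m + 1 : ℕ) * η by push_cast; ring]
    rw [show l - η - s.card * η = l - (s.card + 1 : ℕ) * η by push_cast; ring] at ih
    rw [Matrix.det_principal_insert _ ha haa0, hschur, hprod, haa, Finset.prod_inv_distrib]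
    rw [eq_div_iff h1] at ih
    generalize ((L.frobeniusMatrix x η (l - η)).principal s).det = d at *
    generalize ∏ i ∈ s, r a i ^ 2 = R at *
    generalize ∏ i ∈ s, ∏ j ∈ s.erase i, r i j = E at *
    generalize L.weierstrassSigma (l - (s.card + 1 : ℕ) * η) = t at *
    rw [eq_div_iff h0]
    field_simp
    linear_combination -L.weierstrassSigma η * ih

end PeriodPair

/-! ### The explicit spectral function and its symmetries -/

namespace PeriodPair

variable (L : PeriodPair) {ι : Type*} [Fintype ι] [DecidableEq ι]

/-- The sum `∑ u^(N - |s|) v^|s| ∏_{i ∈ s, j ∉ s} r i j σ(l - |s| η)` over all sets `s` of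
indices. -/
def spectralFun (η : ℂ) (r : ι → ι → ℂ) (u v l : ℂ) : ℂ :=
  ∑ s : Finset ι, u ^ sᶜ.card * v ^ s.card * (∏ i ∈ s, ∏ j ∈ sᶜ, r i j) *
    L.weierstrassSigma (l - s.card * η)

lemma differentiable_spectralFun (η : ℂ) (r : ι → ι → ℂ) :
    Differentiable ℂ fun q : ℂ × ℂ => L.spectralFun η r q.1 1 q.2 := by
  have h := L.differentiable_weierstrassSigma
  unfold spectralFun
  refine Differentiable.fun_sum fun s _ => ?_
  have h2 : Differentiable ℂ fun q : ℂ × ℂ => L.weierstrassSigma (q.2 - s.card * η) :=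
    h.comp (by fun_prop)
  fun_prop

lemma continuous_spectralFun (η : ℂ) (r : ι → ι → ℂ) (u v : ℂ) :
    Continuous (L.spectralFun η r u v) := by
  have h := L.differentiable_weierstrassSigma.continuous
  unfold spectralFun
  fun_prop

lemma spectralFun_mul (η : ℂ) (r : ι → ι → ℂ) (t u v l : ℂ) :
    L.spectralFun η r (t * u) (t * v) l = t ^ Fintype.card ι * L.spectralFun η r u v l := by
  rw [spectralFun, spectralFun, Finset.mul_sum]
  refine Finset.sum_congr rfl fun s _ => ?_
  rw [← Finset.card_compl_add_card s, pow_add, mul_pow, mul_pow]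
  ring

/-- Complementation of s exchanges u and v and sends |s| to N − |s|; the symmetric r leave the
coefficients unchanged and the odd σ produces the sign. This is the source of ι. -/
lemma spectralFun_swap (η : ℂ) {r : ι → ι → ℂ} (hr : ∀ i j, r i j = r j i) (u v l : ℂ) :
    L.spectralFun η r v u (Fintype.card ι * η - l) = -L.spectralFun η r u v l := by
  rw [spectralFun, spectralFun, ← Finset.sum_neg_distrib]
  refine Fintype.sum_equiv (compl_involutive (α := Finset ι)).toPerm _ _ fun s => ?_
  have h1 : (Fintype.card ι : ℂ) = sᶜ.card + s.card := by
    rw [← Nat.cast_add, Finset.card_compl_add_card]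
  have h2 : ∏ i ∈ sᶜ, ∏ j ∈ s, r i j = ∏ i ∈ s, ∏ j ∈ sᶜ, r i j := by
    rw [Finset.prod_comm]
    exact Finset.prod_congr rfl fun i _ => Finset.prod_congr rfl fun j _ => hr _ _
  rw [show (Fintype.card ι : ℂ) * η - l - s.card * η = -(l - sᶜ.card * η) by rw [h1]; ring,
    weierstrassSigma_neg]
  simp only [Function.Involutive.coe_toPerm, compl_compl, h2]
  ring

/-- The summand of s acquires exp(−c|s|η), which is absorbed by rescaling v. -/
lemma spectralFun_add (η : ℂ) (r : ι → ι → ℂ) {w C c : ℂ}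
    (h : ∀ x, L.weierstrassSigma (x + w) = C * Complex.exp (c * x) * L.weierstrassSigma x)
    (u v l : ℂ) : L.spectralFun η r u v (l + w) =
      C * Complex.exp (c * l) * L.spectralFun η r u (Complex.exp (-(c * η)) * v) l := by
  rw [spectralFun, spectralFun, Finset.mul_sum]
  refine Finset.sum_congr rfl fun s _ => ?_
  rw [show l + w - s.card * η = (l - s.card * η) + w by ring, h, mul_pow, ← Complex.exp_nat_mul,
    show c * (l - s.card * η) = c * l + s.card * -(c * η) by ring, Complex.exp_add]
  ring

end PeriodPair

/-! ### From the Lax matrix to the spectral function -/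

namespace RuijsenaarsSchneider

variable {ω₁ ω₂ : ℂ}

/-- The periods `2 ω₁, 2 ω₂`. -/
def periodPair (hω : 0 < (ω₂ / ω₁).im) : PeriodPair where
  ω₁ := 2 * ω₁
  ω₂ := 2 * ω₂
  indep := by
    have h1 : ω₁ ≠ 0 := by
      rintro rfl
      simp at hω
    rw [LinearIndependent.pair_iff]
    intro a b hab
    simp only [Complex.real_smul] at hab
    have h2 : (a : ℂ) + b * (ω₂ / ω₁) = 0 := by
      field_simp
      linear_combination hab / 2
    have h3 : b = 0 := by
      have := congrArg Complex.im h2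
      simp only [Complex.add_im, Complex.ofReal_im, Complex.im_ofReal_mul, zero_add,
        Complex.zero_im, mul_eq_zero] at this
      exact this.resolve_right hω.ne'
    subst h3
    simpa using h2

lemma sigma_eq (hω : 0 < (ω₂ / ω₁).im) :
    sigma ω₁ ω₂ = (periodPair hω).weierstrassSigma := rfl

lemma zeta_eq (hω : 0 < (ω₂ / ω₁).im) {x : ℂ} (hx : x ∉ (periodPair hω).lattice) :
    zeta ω₁ ω₂ x = (periodPair hω).zetaSum x := by
  rw [← PeriodPair.logDeriv_weierstrassSigma _ hx]
  rfl

variable {η : ℂ} {N : ℕ} {x p : Fin N → ℂ} {r : Fin N → Fin N → ℂ}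

/-- The exponentials are a diagonal conjugation and the velocities are row factors. -/
lemma det_principal_laxMatrix (hω : 0 < (ω₂ / ω₁).im) (l : ℂ) (s : Finset (Fin N)) :
    ((laxMatrix ω₁ ω₂ η x p l).principal s).det =
      (∏ i ∈ s, velocity ω₁ ω₂ η x p i) *
        (((periodPair hω).frobeniusMatrix x η l).principal s).det := by
  set Z := zeta ω₁ ω₂ l with hZ
  have hmat : (laxMatrix ω₁ ω₂ η x p l).principal s =
      Matrix.of fun i j : s => (fun i : s => Complex.exp (-(x i * Z)) * velocity ω₁ ω₂ η x p i) i *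
        (Matrix.of fun i j : s => (fun j : s => Complex.exp (x j * Z)) j *
          ((periodPair hω).frobeniusMatrix x η l).principal s i j) i j := by
    ext i j
    change Complex.exp (-(x i - x j) * Z) * _ * ((periodPair hω).frobeniusMatrix x η l i j) = _ *
      (_ * (periodPair hω).frobeniusMatrix x η l i j)
    rw [show -(x i - x j) * Z = -(x i * Z) + x j * Z by ring, Complex.exp_add]
    ring
  rw [hmat, Matrix.det_mul_column, Matrix.det_mul_row, ← mul_assoc, Finset.prod_mul_distrib]
  have h1 : (∏ i : s, Complex.exp (-(x i * Z))) * ∏ i : s, Complex.exp (x i * Z) = 1 := by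
    rw [← Finset.prod_mul_distrib]
    refine Finset.prod_eq_one fun i _ => ?_
    rw [← Complex.exp_add, neg_add_cancel, Complex.exp_zero]
  rw [Finset.prod_coe_sort s fun i => velocity ω₁ ω₂ η x p i]
  linear_combination (∏ i ∈ s, velocity ω₁ ω₂ η x p i) *
    (((periodPair hω).frobeniusMatrix x η l).principal s).det * h1

/-- The curve of a turning point in terms of the square roots `r i k`. -/
lemma curveFun_eq_spectralFun (hω : 0 < (ω₂ / ω₁).im) (hη : η ∉ periodLattice ω₁ ω₂)
    (hx : ∀ i j, i ≠ j → x i - x j ∉ periodLattice ω₁ ω₂)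
    (hxη : ∀ i j, i ≠ j → x i - x j - η ∉ periodLattice ω₁ ω₂)
    (hr : (periodPair hω).IsSqrtFamily x η r)
    (hv : ∀ i, velocity ω₁ ω₂ η x p i = sigma ω₁ ω₂ η * ∏ k ∈ Finset.univ.erase i, r i k)
    (u v l : ℂ) :
    curveFun ω₁ ω₂ η x p u v l = (periodPair hω).spectralFun η r u v l := by
  set L := periodPair hω with hL
  have hσ : ∀ y, y ∉ periodLattice ω₁ ω₂ → L.weierstrassSigma y ≠ 0 :=
    fun y hy h => hy (L.weierstrassSigma_eq_zero_iff.mp h)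
  have hdet := hr.det_frobeniusMatrix (hσ _ hη) (fun i j h => hσ _ (hx i j h))
    (fun i j h => hσ _ (hxη i j h))
  -- Frobenius' formula holds off the zeros of finitely many translates of σ, hence on a punctured
  -- neighbourhood; continuity of the explicit sum then gives the limit.
  have hev : ∀ᶠ m in 𝓝[≠] l, ∀ k ∈ Finset.range (N + 1), L.weierstrassSigma (m - k * η) ≠ 0 := by
    rw [Filter.eventually_all_finset]
    intro k _
    have ht : Tendsto (fun m : ℂ => m - k * η) (𝓝[≠] l) (𝓝[≠] (l - k * η)) := by
      refine tendsto_nhdsWithin_iff.mpr ⟨Continuous.tendsto' (by fun_prop) _ _ rfl |>.mono_left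
        nhdsWithin_le_nhds, ?_⟩
      filter_upwards [self_mem_nhdsWithin] with m hm h
      exact hm (by simpa using h)
    exact ht.eventually (L.eventually_sigma_ne_zero _)
  refine Tendsto.limUnder_eq ?_
  refine (((L.continuous_spectralFun η r u v).tendsto l).mono_left nhdsWithin_le_nhds).congr' ?_
  filter_upwards [hev] with m hm
  have hm0 : L.weierstrassSigma m ≠ 0 := by simpa using hm 0 (by simp)
  rw [Matrix.det_smul_one_sub_smul, PeriodPair.spectralFun, Finset.mul_sum]
  refine Finset.sum_congr rfl fun s _ => ?_
  have hcard : s.card ≤ N := by simpa using s.card_le_univ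
  have h1 := hdet s m fun k hk => hm k (by rw [Finset.mem_range]; omega)
  -- The roots with both indices in s cancel in Frobenius' formula; those leaving s become the
  -- coefficient.
  have h2 : ∏ i ∈ s, velocity ω₁ ω₂ η x p i = L.weierstrassSigma η ^ s.card *
      (∏ i ∈ s, ∏ j ∈ s.erase i, r i j) * ∏ i ∈ s, ∏ j ∈ sᶜ, r i j := by
    rw [← Finset.prod_const, ← Finset.prod_mul_distrib, ← Finset.prod_mul_distrib]
    refine Finset.prod_congr rfl fun i hi => ?_
    have hdisj : Disjoint (s.erase i) sᶜ :=
      Finset.disjoint_of_subset_left (Finset.erase_subset _ _) disjoint_compl_right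
    have hunion : Finset.univ.erase i = s.erase i ∪ sᶜ := by
      ext j
      by_cases hj : j ∈ s
      · simp [hj]
      · have : j ≠ i := by
          rintro rfl
          exact hj hi
        simp [hj, this]
    rw [hv, hunion, Finset.prod_union hdisj, mul_assoc]
    rfl
  rw [det_principal_laxMatrix hω, h2, sigma_eq hω, ← hL]
  rw [eq_div_iff hm0] at h1
  have h3 : (-1 : ℂ) ^ s.card * (-1) ^ s.card = 1 := by rw [← mul_pow]; simp
  rw [neg_pow v]
  linear_combination (-1) * u ^ sᶜ.card * v ^ s.card * (∏ i ∈ s, ∏ j ∈ sᶜ, r i j) *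
    ((-1) ^ s.card * h1 + L.weierstrassSigma (m - s.card * η) * h3)

end RuijsenaarsSchneider

/-! ### Reflections and nonsingularity -/

/-- A function that is antisymmetric to first order at a fixed point of a reflection is
stationary there. -/
lemma fderiv_eq_zero_of_reflection {E : Type*} [NormedAddCommGroup E] [NormedSpace ℂ E]
    {G H : E → ℂ} {T : E → E} {q : E} (hT : HasFDerivAt T (-ContinuousLinearMap.id ℂ E) q)
    (hTq : T q = q) (hG : DifferentiableAt ℂ G q) (hH : DifferentiableAt ℂ H q) (hHq : H q = 1)
    (hGq : G q = 0) (h : G =ᶠ[𝓝 q] fun y => H y * G (T y)) : fderiv ℂ G q = 0 := by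
  have h1 : HasFDerivAt (fun y => G (T y)) (-fderiv ℂ G q) q := by
    have hG' : HasFDerivAt G (fderiv ℂ G q) (T q) := by
      rw [hTq]
      exact hG.hasFDerivAt
    have := hG'.comp q hT
    simpa [ContinuousLinearMap.comp_neg] using! this
  have h2 := (hH.hasFDerivAt.mul h1).congr_of_eventuallyEq h
  rw [hTq, hHq, hGq] at h2
  ext v
  have h3 := DFunLike.congr_fun (hG.hasFDerivAt.unique h2) v
  simp only [one_smul, add_apply, neg_apply, smul_apply, zero_smul, add_zero] at h3
  exact self_eq_neg.mp h3

namespace PeriodPair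

variable (L : PeriodPair)

/-- The multipliers at `2 ω` of `σ`, where `ω` is a half-period or `0`. -/
def IsMultiplier (ω Z s : ℂ) : Prop :=
  ∀ x, L.weierstrassSigma (x + 2 * ω) = s * Complex.exp (2 * Z * (x + ω)) * L.weierstrassSigma x

variable {L} {ι : Type*} [Fintype ι] [DecidableEq ι] {η : ℂ} {r : ι → ι → ℂ} {ω Z s : ℂ}

/-- Swap, translation by 2ω and homogeneity combined. The resulting map is the lift of ι that fixes
(±exp(Zη), Nη/2 − ω), whose class ι fixes. -/
lemma spectralFun_reflection (hr : ∀ i j, r i j = r j i) (hm : L.IsMultiplier ω Z s)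
    {z : ℂ} (hz : z ≠ 0) (l : ℂ) :
    L.spectralFun η r z 1 l =
      -(s * Complex.exp (2 * Z * (Fintype.card ι * η - l - ω)) *
        (Complex.exp (-(2 * Z * η)) * z) ^ Fintype.card ι) *
      L.spectralFun η r (Complex.exp (2 * Z * η) / z) 1 (Fintype.card ι * η - 2 * ω - l) := by
  have h1 := L.spectralFun_swap η hr z 1 l
  have h2 := L.spectralFun_add η r (w := 2 * ω) (C := s * Complex.exp (2 * Z * ω)) (c := 2 * Z)
    (fun x => by rw [hm, mul_add, Complex.exp_add]; ring) 1 z (Fintype.card ι * η - 2 * ω - l)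
  have h3 := L.spectralFun_mul η r (Complex.exp (-(2 * Z * η)) * z)
    (Complex.exp (2 * Z * η) / z) 1 (Fintype.card ι * η - 2 * ω - l)
  have h4 : Complex.exp (-(2 * Z * η)) * z * (Complex.exp (2 * Z * η) / z) = 1 := by
    rw [mul_assoc, mul_div_cancel₀ _ hz, ← Complex.exp_add, neg_add_cancel, Complex.exp_zero]
  rw [h4, mul_one] at h3
  rw [show (Fintype.card ι : ℂ) * η - 2 * ω - l + 2 * ω = Fintype.card ι * η - l by ring, h1, h3]
    at h2
  rw [show 2 * Z * (Fintype.card ι * η - l - ω) =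
    2 * Z * ω + 2 * Z * (Fintype.card ι * η - 2 * ω - l) by ring, Complex.exp_add]
  linear_combination -h2

/-- The fixed points of the involution that lie on a nonsingular curve. -/
lemma spectralFun_eq_zero_iff (hr : ∀ i j, r i j = r j i) (hm : L.IsMultiplier ω Z s)
    {ε : ℂ} (hε : ε ^ 2 = 1) (hs : s ^ 2 = 1)
    (hsmooth : ∀ z l : ℂ, L.spectralFun η r z 1 l = 0 →
      fderiv ℂ (fun q : ℂ × ℂ => L.spectralFun η r q.1 1 q.2) (z, l) ≠ 0) :
    L.spectralFun η r (ε * Complex.exp (Z * η)) 1 (Fintype.card ι * η / 2 - ω) = 0 ↔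
      s * ε ^ Fintype.card ι = 1 := by
  set n := Fintype.card ι with hn
  set z := ε * Complex.exp (Z * η) with hz
  set l := n * η / 2 - ω with hl
  have hε0 : ε ≠ 0 := by
    rintro rfl
    norm_num at hε
  have hz0 : z ≠ 0 := mul_ne_zero hε0 (Complex.exp_ne_zero _)
  have hz2 : z ^ 2 = Complex.exp (2 * Z * η) := by
    rw [hz, mul_pow, hε, one_mul, ← Complex.exp_nat_mul]
    congr 1
    push_cast
    ring
  have hTz : Complex.exp (2 * Z * η) / z = z := by rw [← hz2, pow_two, mul_div_cancel_right₀ _ hz0]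
  have hTl : n * η - 2 * ω - l = l := by rw [hl]; ring
  -- At the fixed point all exponentials cancel, so the reflection factor is −sε^n, which is ±1.
  have hH : s * Complex.exp (2 * Z * (n * η - l - ω)) * (Complex.exp (-(2 * Z * η)) * z) ^ n =
      s * ε ^ n := by
    rw [show Complex.exp (-(2 * Z * η)) * z = ε * Complex.exp (-(Z * η)) by
      rw [hz, mul_left_comm, ← Complex.exp_add]
      congr 2
      ring]
    rw [mul_pow, ← Complex.exp_nat_mul, hl,
      show 2 * Z * (n * η - (n * η / 2 - ω) - ω) = -(n * -(Z * η)) by ring]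
    have h := Complex.exp_ne_zero (n * -(Z * η))
    rw [Complex.exp_neg]
    field_simp
  have hrefl := spectralFun_reflection (η := η) hr hm hz0 l
  rw [hTz, hTl, hH] at hrefl
  have hsq : (s * ε ^ n) ^ 2 = 1 := by
    rw [mul_pow, hs, one_mul, ← pow_mul, mul_comm n 2, pow_mul, hε, one_pow]
  constructor
  · intro h0
    rcases mul_self_eq_one_iff.mp ((pow_two _).symm.trans hsq) with h | h
    · exact h
    -- Here the reflection factor is +1, so a zero would be a critical point of the equation.
    · exfalso
      refine hsmooth z l h0 ?_
      refine fderiv_eq_zero_of_reflection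
        (H := fun q : ℂ × ℂ => -(s * Complex.exp (2 * Z * (n * η - q.2 - ω)) *
          (Complex.exp (-(2 * Z * η)) * q.1) ^ n))
        (T := fun q : ℂ × ℂ => (Complex.exp (2 * Z * η) / q.1, n * η - 2 * ω - q.2)) ?_ ?_
        (L.differentiable_spectralFun η r _) (by fun_prop) ?_ h0 ?_
      · have h1 : HasFDerivAt (fun q : ℂ × ℂ => Complex.exp (2 * Z * η) / q.1)
            (-ContinuousLinearMap.fst ℂ ℂ ℂ) (z, l) := by
          have hd : HasDerivAt (fun y : ℂ => Complex.exp (2 * Z * η) / y) (-1) z := by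
            have := (hasDerivAt_inv hz0).const_mul (Complex.exp (2 * Z * η))
            convert! this using 1
            rw [← hz2]
            field_simp
          have hf : HasFDerivAt (Prod.fst : ℂ × ℂ → ℂ) (ContinuousLinearMap.fst ℂ ℂ ℂ) (z, l) :=
            hasFDerivAt_fst
          have := hd.comp_hasFDerivAt (z, l) hf
          rwa [show (-1 : ℂ) • ContinuousLinearMap.fst ℂ ℂ ℂ = -ContinuousLinearMap.fst ℂ ℂ ℂ by
            ext <;> simp] at this
        have h2 : HasFDerivAt (fun q : ℂ × ℂ => n * η - 2 * ω - q.2)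
            (-ContinuousLinearMap.snd ℂ ℂ ℂ) (z, l) := hasFDerivAt_snd.const_sub _
        convert! h1.prodMk h2 using 1
      · simp only [hTz, hTl]
      · simp only [hH, h, neg_neg]
      · have hopen : ∀ᶠ q : ℂ × ℂ in 𝓝 (z, l), q.1 ≠ 0 :=
          continuous_fst.continuousAt.eventually_ne hz0
        filter_upwards [hopen] with q hq
        exact spectralFun_reflection hr hm hq q.2
  · intro h
    -- The reflection factor is −1, so the value equals its own negative.
    rw [h, neg_one_mul] at hrefl
    exact self_eq_neg.mp hrefl

end PeriodPair

/-! ### Periods, half-periods and multipliers -/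

namespace RuijsenaarsSchneider

variable {ω₁ ω₂ : ℂ}

lemma mem_periodLattice_iff {ω₁ ω₂ w : ℂ} :
    w ∈ periodLattice ω₁ ω₂ ↔ ∃ m n : ℤ, w = 2 * m * ω₁ + 2 * n * ω₂ := by
  rw [periodLattice, Submodule.mem_span_pair]
  simp only [zsmul_eq_mul]
  constructor
  · rintro ⟨m, n, h⟩
    exact ⟨m, n, by rw [← h]; ring⟩
  · rintro ⟨m, n, h⟩
    exact ⟨m, n, by rw [h]; ring⟩

lemma int_mul_add_int_mul_eq_zero (hω : 0 < (ω₂ / ω₁).im) {a b : ℤ}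
    (h : (a : ℂ) * ω₁ + b * ω₂ = 0) : a = 0 ∧ b = 0 := by
  have h1 := LinearIndependent.pair_iff.mp (periodPair hω).indep a b (by
    simp only [Complex.real_smul, Complex.ofReal_intCast, periodPair]
    linear_combination 2 * h)
  exact_mod_cast h1

lemma int_mul_add_int_mul_mem_iff (hω : 0 < (ω₂ / ω₁).im) {a b : ℤ} :
    (a : ℂ) * ω₁ + b * ω₂ ∈ periodLattice ω₁ ω₂ ↔ Even a ∧ Even b := by
  rw [mem_periodLattice_iff]
  constructor
  · rintro ⟨m, n, h⟩
    have h1 := int_mul_add_int_mul_eq_zero hω (a := a - 2 * m) (b := b - 2 * n) (by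
      push_cast
      linear_combination h)
    exact ⟨⟨m, by omega⟩, ⟨n, by omega⟩⟩
  · rintro ⟨⟨m, rfl⟩, ⟨n, rfl⟩⟩
    exact ⟨m, n, by push_cast; ring⟩

lemma notMem_periodLattice (hω : 0 < (ω₂ / ω₁).im) :
    ω₁ ∉ periodLattice ω₁ ω₂ ∧ ω₂ ∉ periodLattice ω₁ ω₂ ∧ ω₁ + ω₂ ∉ periodLattice ω₁ ω₂ := by
  refine ⟨?_, ?_, ?_⟩
  · simpa using (int_mul_add_int_mul_mem_iff hω (a := 1) (b := 0)).not.mpr (by simp)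
  · simpa using (int_mul_add_int_mul_mem_iff hω (a := 0) (b := 1)).not.mpr (by simp)
  · simpa using (int_mul_add_int_mul_mem_iff hω (a := 1) (b := 1)).not.mpr (by simp)

lemma zeta_add (hω : 0 < (ω₂ / ω₁).im) :
    zeta ω₁ ω₂ (ω₁ + ω₂) = zeta ω₁ ω₂ ω₁ + zeta ω₁ ω₂ ω₂ := by
  obtain ⟨h1, h2, h3⟩ := notMem_periodLattice hω
  rw [zeta_eq hω h1, zeta_eq hω h2, zeta_eq hω h3]
  exact (periodPair hω).zetaSum_add_half_periods h1 (PeriodPair.ω₁_mem_lattice _) h2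
    (PeriodPair.ω₂_mem_lattice _) h3

/-- The sign in the quasi-periodicity of `σ` with respect to `2 ω`, where `ω = a ω₁ + b ω₂`. -/
def multiplierSign (a b : ℤ) : ℂ := if a = 0 ∧ b = 0 then 1 else -1

/-- Only a = b = 0 gives a lattice point, with trivial translation; the other three are genuine
half-periods, with sign −1, and additivity of ζ at half-periods handles ω₁ + ω₂. -/
lemma isMultiplier (hω : 0 < (ω₂ / ω₁).im) {a b : ℤ} (ha : a = 0 ∨ a = 1) (hb : b = 0 ∨ b = 1) :
    (periodPair hω).IsMultiplier (a * ω₁ + b * ω₂)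
      (a * zeta ω₁ ω₂ ω₁ + b * zeta ω₁ ω₂ ω₂) (multiplierSign a b) := by
  obtain ⟨h1, h2, h3⟩ := notMem_periodLattice hω
  have hm1 : 2 * ω₁ ∈ (periodPair hω).lattice := PeriodPair.ω₁_mem_lattice _
  have hm2 : 2 * ω₂ ∈ (periodPair hω).lattice := PeriodPair.ω₂_mem_lattice _
  have hm3 : 2 * (ω₁ + ω₂) ∈ (periodPair hω).lattice := by
    rw [mul_add]
    exact add_mem hm1 hm2
  have key : ∀ ω ∉ periodLattice ω₁ ω₂, 2 * ω ∈ (periodPair hω).lattice →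
      (periodPair hω).IsMultiplier ω (zeta ω₁ ω₂ ω) (-1) := by
    intro ω hω1 hω2 y
    rw [zeta_eq hω hω1, (periodPair hω).weierstrassSigma_add_two_mul hω1 hω2, neg_one_mul]
  rcases ha with rfl | rfl <;> rcases hb with rfl | rfl
  · intro y
    simp [multiplierSign]
  · simpa [multiplierSign] using key _ h2 hm2
  · simpa [multiplierSign] using key _ h1 hm1
  · have := key _ h3 hm3
    rw [zeta_add hω] at this
    simpa [multiplierSign] using this

/-- The multipliers of `σ` with respect to all the periods. -/
lemma exists_sigma_add (hω : 0 < (ω₂ / ω₁).im) (m n : ℤ) :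
    ∃ C ≠ 0, ∀ y, (periodPair hω).weierstrassSigma (y + (2 * m * ω₁ + 2 * n * ω₂)) =
      C * Complex.exp (2 * (m * zeta ω₁ ω₂ ω₁ + n * zeta ω₁ ω₂ ω₂) * y) *
        (periodPair hω).weierstrassSigma y := by
  set L := periodPair hω with hL
  obtain ⟨h1, h2, -⟩ := notMem_periodLattice hω
  have hm1 : 2 * ω₁ ∈ L.lattice := PeriodPair.ω₁_mem_lattice _
  have hm2 : 2 * ω₂ ∈ L.lattice := PeriodPair.ω₂_mem_lattice _
  -- Pairs of a period and its additive constant for ζ form a group, so the two generators determine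
  -- every constant.
  let A : AddSubgroup (ℂ × ℂ) :=
    { carrier := {q | q.1 ∈ L.lattice ∧ ∀ y ∉ L.lattice, L.zetaSum (y + q.1) = L.zetaSum y + q.2}
      zero_mem' := ⟨zero_mem _, fun y _ => by simp⟩
      add_mem' := by
        rintro q q' ⟨hq, h⟩ ⟨hq', h'⟩
        refine ⟨add_mem hq hq', fun y hy => ?_⟩
        have hy' : y + q.1 ∉ L.lattice := fun h => hy (by simpa using sub_mem h hq)
        rw [Prod.fst_add, Prod.snd_add, ← add_assoc, h' _ hy', h _ hy, add_assoc]
      neg_mem' := by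
        rintro q ⟨hq, h⟩
        refine ⟨neg_mem hq, fun y hy => ?_⟩
        have hy' : y + -q.1 ∉ L.lattice := fun h => hy (by simpa using add_mem h hq)
        have := h _ hy'
        rw [neg_add_cancel_right] at this
        rw [Prod.fst_neg, Prod.snd_neg, this, add_neg_cancel_right] }
  have hA1 : (2 * ω₁, 2 * L.zetaSum ω₁) ∈ A :=
    ⟨hm1, fun y hy => L.zetaSum_add_two_mul h1 hm1 hy⟩
  have hA2 : (2 * ω₂, 2 * L.zetaSum ω₂) ∈ A :=
    ⟨hm2, fun y hy => L.zetaSum_add_two_mul h2 hm2 hy⟩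
  obtain ⟨hw, hc⟩ := add_mem (zsmul_mem hA1 m) (zsmul_mem hA2 n)
  obtain ⟨C, hC0, hC⟩ := L.exists_weierstrassSigma_add hw hc
  refine ⟨C, hC0, fun y => ?_⟩
  convert hC y using 4
  · simp only [Prod.fst_add, Prod.smul_fst]
    simp only [zsmul_eq_mul]
    ring
  · rw [zeta_eq hω h1, zeta_eq hω h2]
    simp only [Prod.snd_add, Prod.smul_snd]
    simp only [zsmul_eq_mul]
    ring

end RuijsenaarsSchneider

/-! ### The involution on the spectral curve -/

namespace RuijsenaarsSchneider

variable {ω₁ ω₂ η : ℂ} {N : ℕ} {x p : Fin N → ℂ} {r : Fin N → Fin N → ℂ}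

lemma twist_coe (m n : ℤ) (z : ℂ) : twist ω₁ ω₂ η m n (z : OnePoint ℂ) =
    ((Complex.exp (-2 * (m * zeta ω₁ ω₂ ω₁ + n * zeta ω₁ ω₂ ω₂) * η) * z : ℂ) : OnePoint ℂ) := rfl

lemma twist_infty (m n : ℤ) : twist ω₁ ω₂ η m n OnePoint.infty = OnePoint.infty := rfl

lemma recip_zero : recip ((0 : ℂ) : OnePoint ℂ) = OnePoint.infty := by simp [recip]

lemma recip_infty : recip OnePoint.infty = ((0 : ℂ) : OnePoint ℂ) := rfl

lemma recip_coe {z : ℂ} (hz : z ≠ 0) : recip (z : OnePoint ℂ) = ((z⁻¹ : ℂ) : OnePoint ℂ) := by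
  simp [recip, hz]

lemma toAmbient_eq_iff {P Q : OnePoint ℂ × ℂ} :
    toAmbient ω₁ ω₂ η P = toAmbient ω₁ ω₂ η Q ↔
      ∃ m n : ℤ, Q.2 = P.2 + 2 * m * ω₁ + 2 * n * ω₂ ∧ Q.1 = twist ω₁ ω₂ η m n P.1 :=
  Quotient.eq

lemma point_eq_iff {z l z' l' : ℂ} :
    point ω₁ ω₂ η z l = point ω₁ ω₂ η z' l' ↔
      ∃ m n : ℤ, l' = l + 2 * m * ω₁ + 2 * n * ω₂ ∧
        z' = Complex.exp (-2 * (m * zeta ω₁ ω₂ ω₁ + n * zeta ω₁ ω₂ ω₂) * η) * z := by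
  simp only [point, toAmbient_eq_iff, twist_coe, OnePoint.coe_eq_coe]

lemma iota_toAmbient (P : OnePoint ℂ × ℂ) :
    iota ω₁ ω₂ η N (toAmbient ω₁ ω₂ η P) = toAmbient ω₁ ω₂ η (recip P.1, N * η - P.2) := rfl

lemma mem_coveringCurve_coe {z l : ℂ} :
    ((z : OnePoint ℂ), l) ∈ coveringCurve ω₁ ω₂ η x p ↔ curveFun ω₁ ω₂ η x p z 1 l = 0 := by
  simp [coveringCurve]

lemma mem_coveringCurve_infty {l : ℂ} :
    (OnePoint.infty, l) ∈ coveringCurve ω₁ ω₂ η x p ↔ curveFun ω₁ ω₂ η x p 1 0 l = 0 := by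
  simp [coveringCurve]

section Curve

variable (hω : 0 < (ω₂ / ω₁).im)
  (hF : ∀ u v l, curveFun ω₁ ω₂ η x p u v l = (periodPair hω).spectralFun η r u v l)

include hF

lemma recip_mem_coveringCurve (hr : ∀ i k, r i k = r k i) {P : OnePoint ℂ × ℂ}
    (hP : P ∈ coveringCurve ω₁ ω₂ η x p) :
    (recip P.1, N * η - P.2) ∈ coveringCurve ω₁ ω₂ η x p := by
  obtain ⟨z, l⟩ := P
  have hswap := fun u v => (periodPair hω).spectralFun_swap η hr u v l
  rw [Fintype.card_fin] at hswap
  induction z using OnePoint.rec with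
  | infty =>
    rw [mem_coveringCurve_infty, hF] at hP
    rw [recip_infty, mem_coveringCurve_coe, hF, hswap, hP, neg_zero]
  | coe z =>
    rw [mem_coveringCurve_coe, hF] at hP
    by_cases hz : z = 0
    · subst hz
      rw [recip_zero, mem_coveringCurve_infty, hF, hswap, hP, neg_zero]
    · rw [recip_coe hz, mem_coveringCurve_coe, hF]
      have h := (periodPair hω).spectralFun_mul η r z z⁻¹ 1 (N * η - l)
      rw [mul_inv_cancel₀ hz, mul_one, hswap, hP, neg_zero] at h
      exact (mul_eq_zero.mp h.symm).resolve_left (pow_ne_zero _ hz)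

lemma twist_mem_coveringCurve (m n : ℤ) {P : OnePoint ℂ × ℂ}
    (hP : P ∈ coveringCurve ω₁ ω₂ η x p) :
    (twist ω₁ ω₂ η m n P.1, P.2 + 2 * m * ω₁ + 2 * n * ω₂) ∈ coveringCurve ω₁ ω₂ η x p := by
  obtain ⟨z, l⟩ := P
  obtain ⟨C, -, hC⟩ := exists_sigma_add hω m n
  have hadd := (periodPair hω).spectralFun_add η r hC
  induction z using OnePoint.rec with
  | infty =>
    rw [mem_coveringCurve_infty, hF] at hP
    rw [twist_infty, mem_coveringCurve_infty, hF, add_assoc, hadd, mul_zero, hP, mul_zero]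
  | coe z =>
    rw [mem_coveringCurve_coe, hF] at hP
    rw [twist_coe, mem_coveringCurve_coe, hF, add_assoc, hadd,
      show -2 * (m * zeta ω₁ ω₂ ω₁ + n * zeta ω₁ ω₂ ω₂) * η =
        -(2 * (m * zeta ω₁ ω₂ ω₁ + n * zeta ω₁ ω₂ ω₂) * η) by ring,
      PeriodPair.spectralFun_mul, hP, mul_zero, mul_zero]

/-- The covering curve is stable under the deck group, so membership can be tested on any
representative. -/
lemma mem_spectralCurve_iff {P : OnePoint ℂ × ℂ} :
    toAmbient ω₁ ω₂ η P ∈ spectralCurve ω₁ ω₂ η x p ↔ P ∈ coveringCurve ω₁ ω₂ η x p := by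
  constructor
  · rintro ⟨Q, hQ, h⟩
    obtain ⟨m, n, h2, h1⟩ := toAmbient_eq_iff.mp h
    have := twist_mem_coveringCurve hω hF m n hQ
    rwa [← h1, ← h2] at this
  · exact fun h => ⟨P, h, rfl⟩

end Curve

/-- The fixed points of the involution on the ambient surface that are not at `z = 0, ∞`. -/
lemma exists_eq_point_of_iota_eq {P : Ambient ω₁ ω₂ η} (hP : iota ω₁ ω₂ η N P = P) :
    ∃ a b : ℤ, (a = 0 ∨ a = 1) ∧ (b = 0 ∨ b = 1) ∧ ∃ ε : ℂ, ε ^ 2 = 1 ∧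
      P = point ω₁ ω₂ η (ε * Complex.exp ((a * zeta ω₁ ω₂ ω₁ + b * zeta ω₁ ω₂ ω₂) * η))
        (N * η / 2 - (a * ω₁ + b * ω₂)) := by
  obtain ⟨⟨z, l⟩, rfl⟩ := Quotient.exists_rep P
  change iota ω₁ ω₂ η N (toAmbient ω₁ ω₂ η (z, l)) = toAmbient ω₁ ω₂ η (z, l) at hP
  rw [iota_toAmbient, toAmbient_eq_iff] at hP
  obtain ⟨m, n, h2, h1⟩ := hP
  simp only at h1 h2
  induction z using OnePoint.rec with
  | infty =>
    rw [recip_infty, twist_coe] at h1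
    exact absurd h1 (OnePoint.infty_ne_coe _)
  | coe z =>
    by_cases hz : z = 0
    · subst hz
      rw [recip_zero, twist_infty] at h1
      exact absurd h1 (OnePoint.coe_ne_infty _)
    · rw [recip_coe hz, twist_coe, OnePoint.coe_eq_coe, ← div_eq_mul_inv, eq_div_iff hz] at h1
      -- Only the parities of m and n matter: the even parts are removed by a deck transformation,
      -- which leaves aω₁ + bω₂ with a, b ∈ {0, 1}.
      obtain ⟨M, a, ha, hM⟩ : ∃ M a : ℤ, (a = 0 ∨ a = 1) ∧ m = 2 * M - a :=
        ⟨(m + m % 2) / 2, m % 2, by omega, by omega⟩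
      obtain ⟨M', b, hb, hM'⟩ : ∃ M b : ℤ, (b = 0 ∨ b = 1) ∧ n = 2 * M - b :=
        ⟨(n + n % 2) / 2, n % 2, by omega, by omega⟩
      -- The fixed point equation is z² = exp(−2(mζ(ω₁) + nζ(ω₂))η), so this ε is the sign left
      -- after dividing z by a chosen root.
      refine ⟨a, b, ha, hb, Complex.exp ((m * zeta ω₁ ω₂ ω₁ + n * zeta ω₁ ω₂ ω₂) * η) * z, ?_, ?_⟩
      · rw [mul_pow, pow_two z, h1, ← Complex.exp_nat_mul, ← Complex.exp_add]
        convert Complex.exp_zero using 2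
        push_cast
        ring
      · change point ω₁ ω₂ η z l = _
        refine point_eq_iff.mpr ⟨-M, -M', ?_, ?_⟩
        · rw [hM, hM'] at h2
          push_cast at h2 ⊢
          linear_combination -h2 / 2
        · rw [mul_right_comm, ← Complex.exp_add, hM, hM']
          congr 2
          push_cast
          ring

lemma iota_point (a b : ℤ) {ε : ℂ} (hε : ε ^ 2 = 1) :
    iota ω₁ ω₂ η N (point ω₁ ω₂ η
      (ε * Complex.exp ((a * zeta ω₁ ω₂ ω₁ + b * zeta ω₁ ω₂ ω₂) * η))
        (N * η / 2 - (a * ω₁ + b * ω₂))) =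
      point ω₁ ω₂ η (ε * Complex.exp ((a * zeta ω₁ ω₂ ω₁ + b * zeta ω₁ ω₂ ω₂) * η))
        (N * η / 2 - (a * ω₁ + b * ω₂)) := by
  have hε0 : ε ≠ 0 := by
    rintro rfl
    norm_num at hε
  have hinv : ε⁻¹ = ε := inv_eq_of_mul_eq_one_left (by rw [← pow_two, hε])
  rw [point, iota_toAmbient, recip_coe (mul_ne_zero hε0 (Complex.exp_ne_zero _)), mul_inv, hinv,
    ← Complex.exp_neg]
  refine point_eq_iff.mpr ⟨-a, -b, ?_, ?_⟩
  · push_cast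
    ring
  · rw [mul_left_comm, ← Complex.exp_add]
    congr 2
    push_cast
    ring

/-- The fixed points of the involution on a nonsingular curve. -/
lemma mem_fixedPoints_iff (hω : 0 < (ω₂ / ω₁).im)
    (hF : ∀ u v l, curveFun ω₁ ω₂ η x p u v l = (periodPair hω).spectralFun η r u v l)
    (hr : ∀ i k, r i k = r k i) (hsmooth : IsNonsingular ω₁ ω₂ η x p) (P : Ambient ω₁ ω₂ η) :
    P ∈ {P ∈ spectralCurve ω₁ ω₂ η x p | iota ω₁ ω₂ η N P = P} ↔
      ∃ a b : ℤ, (a = 0 ∨ a = 1) ∧ (b = 0 ∨ b = 1) ∧ ∃ ε : ℂ, ε ^ 2 = 1 ∧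
        multiplierSign a b * ε ^ N = 1 ∧
        P = point ω₁ ω₂ η (ε * Complex.exp ((a * zeta ω₁ ω₂ ω₁ + b * zeta ω₁ ω₂ ω₂) * η))
          (N * η / 2 - (a * ω₁ + b * ω₂)) := by
  have hsmooth' : ∀ z l : ℂ, (periodPair hω).spectralFun η r z 1 l = 0 →
      fderiv ℂ (fun q : ℂ × ℂ => (periodPair hω).spectralFun η r q.1 1 q.2) (z, l) ≠ 0 := by
    simpa only [IsNonsingular, hF] using hsmooth
  have hmem : ∀ a b : ℤ, (a = 0 ∨ a = 1) → (b = 0 ∨ b = 1) → ∀ ε : ℂ, ε ^ 2 = 1 →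
      (point ω₁ ω₂ η (ε * Complex.exp ((a * zeta ω₁ ω₂ ω₁ + b * zeta ω₁ ω₂ ω₂) * η))
        (N * η / 2 - (a * ω₁ + b * ω₂)) ∈ spectralCurve ω₁ ω₂ η x p ↔
        multiplierSign a b * ε ^ N = 1) := by
    intro a b ha hb ε hε
    have h := PeriodPair.spectralFun_eq_zero_iff (η := η) hr (isMultiplier hω ha hb) hε
      (by unfold multiplierSign; split_ifs <;> simp) hsmooth'
    rw [Fintype.card_fin] at h
    rw [point, mem_spectralCurve_iff hω hF, mem_coveringCurve_coe, hF, h]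
  constructor
  · rintro ⟨hP, hfix⟩
    obtain ⟨a, b, ha, hb, ε, hε, rfl⟩ := exists_eq_point_of_iota_eq hfix
    exact ⟨a, b, ha, hb, ε, hε, (hmem a b ha hb ε hε).mp hP, rfl⟩
  · rintro ⟨a, b, ha, hb, ε, hε, h, rfl⟩
    exact ⟨(hmem a b ha hb ε hε).mpr h, iota_point a b hε⟩

/-- For even N one has ε^N = 1, so the multiplier sign must be 1, which leaves ω = 0 and both signs
ε. -/
lemma fixedPoints_even (hω : 0 < (ω₂ / ω₁).im)
    (hF : ∀ u v l, curveFun ω₁ ω₂ η x p u v l = (periodPair hω).spectralFun η r u v l)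
    (hr : ∀ i k, r i k = r k i) (hsmooth : IsNonsingular ω₁ ω₂ η x p) (hN : Even N) :
    {P ∈ spectralCurve ω₁ ω₂ η x p | iota ω₁ ω₂ η N P = P} =
      {point ω₁ ω₂ η 1 (N * η / 2), point ω₁ ω₂ η (-1) (N * η / 2)} := by
  ext P
  rw [mem_fixedPoints_iff hω hF hr hsmooth, Set.mem_insert_iff, Set.mem_singleton_iff]
  constructor
  · rintro ⟨a, b, -, -, ε, hε, h, rfl⟩
    obtain ⟨k, rfl⟩ := hN
    rw [← two_mul, pow_mul, hε, one_pow, mul_one] at h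
    have hab : a = 0 ∧ b = 0 := by
      by_contra hab
      rw [multiplierSign, if_neg hab] at h
      norm_num at h
    obtain ⟨rfl, rfl⟩ := hab
    rcases mul_self_eq_one_iff.mp ((pow_two _).symm.trans hε) with rfl | rfl <;> simp
  · rintro (rfl | rfl)
    · exact ⟨0, 0, .inl rfl, .inl rfl, 1, by norm_num, by simp [multiplierSign], by simp⟩
    · exact ⟨0, 0, .inl rfl, .inl rfl, -1, by norm_num, by simp [multiplierSign, hN.neg_one_pow],
        by simp⟩

/-- For odd N one has ε^N = ε, so ε is forced to equal the multiplier sign: 1 at ω = 0 and −1 at the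
half-periods. -/
lemma fixedPoints_odd (hω : 0 < (ω₂ / ω₁).im)
    (hF : ∀ u v l, curveFun ω₁ ω₂ η x p u v l = (periodPair hω).spectralFun η r u v l)
    (hr : ∀ i k, r i k = r k i) (hsmooth : IsNonsingular ω₁ ω₂ η x p) (hN : Odd N) :
    {P ∈ spectralCurve ω₁ ω₂ η x p | iota ω₁ ω₂ η N P = P} =
      {point ω₁ ω₂ η 1 (N * η / 2),
        point ω₁ ω₂ η (-Complex.exp (zeta ω₁ ω₂ ω₁ * η)) (N * η / 2 - ω₁),
        point ω₁ ω₂ η (-Complex.exp (zeta ω₁ ω₂ ω₂ * η)) (N * η / 2 - ω₂),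
        point ω₁ ω₂ η (-Complex.exp (zeta ω₁ ω₂ (ω₁ + ω₂) * η)) (N * η / 2 - (ω₁ + ω₂))} := by
  ext P
  rw [mem_fixedPoints_iff hω hF hr hsmooth]
  simp only [Set.mem_insert_iff, Set.mem_singleton_iff, zeta_add hω]
  constructor
  · rintro ⟨a, b, ha, hb, ε, hε, h, rfl⟩
    have hεN : ε ^ N = ε := by
      obtain ⟨k, rfl⟩ := hN
      rw [pow_succ, pow_mul, hε, one_pow, one_mul]
    rw [hεN] at h
    rcases ha with rfl | rfl <;> rcases hb with rfl | rfl
    · have : ε = 1 := by simpa [multiplierSign] using h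
      simp [this]
    all_goals
      have : ε = -1 := by
        simp only [multiplierSign] at h
        norm_num at h
        linear_combination -h
      simp [this]
  · rintro (rfl | rfl | rfl | rfl)
    · exact ⟨0, 0, .inl rfl, .inl rfl, 1, by norm_num, by simp [multiplierSign], by simp⟩
    · exact ⟨1, 0, .inr rfl, .inl rfl, -1, by norm_num, by simp [multiplierSign, hN.neg_one_pow],
        by simp⟩
    · exact ⟨0, 1, .inl rfl, .inr rfl, -1, by norm_num, by simp [multiplierSign, hN.neg_one_pow],
        by simp⟩
    · exact ⟨1, 1, .inr rfl, .inr rfl, -1, by norm_num, by simp [multiplierSign, hN.neg_one_pow],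
        by simp⟩

lemma point_ne_of_sub_notMem {z l z' l' : ℂ} (h : l' - l ∉ periodLattice ω₁ ω₂) :
    point ω₁ ω₂ η z l ≠ point ω₁ ω₂ η z' l' := by
  intro h'
  obtain ⟨m, n, hl, -⟩ := point_eq_iff.mp h'
  exact h (mem_periodLattice_iff.mpr ⟨m, n, by rw [hl]; ring⟩)

/-- The deck group acts freely on the second coordinate, so only the identity preserves it. -/
lemma point_injective (hω : 0 < (ω₂ / ω₁).im) {z z' l : ℂ}
    (h : point ω₁ ω₂ η z l = point ω₁ ω₂ η z' l) : z = z' := by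
  obtain ⟨m, n, hl, hz⟩ := point_eq_iff.mp h
  have h1 := int_mul_add_int_mul_eq_zero hω (a := m) (b := n) (by linear_combination -hl / 2)
  rw [hz, h1.1, h1.2]
  simp

end RuijsenaarsSchneider

end

theorem mainTheorem5 (ω₁ ω₂ η : ℂ) (hω : 0 < (ω₂ / ω₁).im)
    (hη : η ∉ RuijsenaarsSchneider.periodLattice ω₁ ω₂)
    (N : ℕ) (hN : 1 ≤ N) (x p : Fin N → ℂ)
    (hx : ∀ i j, i ≠ j → x i - x j ∉ RuijsenaarsSchneider.periodLattice ω₁ ω₂)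
    (hxη : ∀ i j, i ≠ j → x i - x j - η ∉ RuijsenaarsSchneider.periodLattice ω₁ ω₂)
    (hturn : RuijsenaarsSchneider.IsTurningPoint ω₁ ω₂ η x p)
    (hsmooth : RuijsenaarsSchneider.IsNonsingular ω₁ ω₂ η x p) :
    Set.MapsTo (RuijsenaarsSchneider.iota ω₁ ω₂ η N)
      (RuijsenaarsSchneider.spectralCurve ω₁ ω₂ η x p)
      (RuijsenaarsSchneider.spectralCurve ω₁ ω₂ η x p) ∧
    (Even N →
      {P ∈ RuijsenaarsSchneider.spectralCurve ω₁ ω₂ η x p |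
          RuijsenaarsSchneider.iota ω₁ ω₂ η N P = P} =
        {RuijsenaarsSchneider.point ω₁ ω₂ η 1 (N * η / 2),
          RuijsenaarsSchneider.point ω₁ ω₂ η (-1) (N * η / 2)} ∧
      {P ∈ RuijsenaarsSchneider.spectralCurve ω₁ ω₂ η x p |
          RuijsenaarsSchneider.iota ω₁ ω₂ η N P = P}.ncard = 2) ∧
    (Odd N →
      {P ∈ RuijsenaarsSchneider.spectralCurve ω₁ ω₂ η x p |
          RuijsenaarsSchneider.iota ω₁ ω₂ η N P = P} =
        {RuijsenaarsSchneider.point ω₁ ω₂ η 1 (N * η / 2),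
          RuijsenaarsSchneider.point ω₁ ω₂ η
            (-Complex.exp (RuijsenaarsSchneider.zeta ω₁ ω₂ ω₁ * η)) (N * η / 2 - ω₁),
          RuijsenaarsSchneider.point ω₁ ω₂ η
            (-Complex.exp (RuijsenaarsSchneider.zeta ω₁ ω₂ ω₂ * η)) (N * η / 2 - ω₂),
          RuijsenaarsSchneider.point ω₁ ω₂ η
            (-Complex.exp (RuijsenaarsSchneider.zeta ω₁ ω₂ (ω₁ + ω₂) * η))
            (N * η / 2 - (ω₁ + ω₂))} ∧
      {P ∈ RuijsenaarsSchneider.spectralCurve ω₁ ω₂ η x p |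
          RuijsenaarsSchneider.iota ω₁ ω₂ η N P = P}.ncard = 4) := by
  open RuijsenaarsSchneider in
  obtain ⟨-, r, hr, hr2, hv⟩ := hturn
  have hF := curveFun_eq_spectralFun hω hη hx hxη ⟨hr, hr2⟩ hv
  refine ⟨?_, fun hN => ?_, fun hN => ?_⟩
  · rintro _ ⟨P, hP, rfl⟩
    exact ⟨_, recip_mem_coveringCurve hω hF hr hP, rfl⟩
  · refine ⟨fixedPoints_even hω hF hr hsmooth hN, ?_⟩
    rw [fixedPoints_even hω hF hr hsmooth hN]
    refine Set.ncard_pair fun h => ?_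
    have := point_injective hω h
    norm_num at this
  · refine ⟨fixedPoints_odd hω hF hr hsmooth hN, ?_⟩
    rw [fixedPoints_odd hω hF hr hsmooth hN]
    obtain ⟨h1, h2, h3⟩ := notMem_periodLattice hω
    have h4 : ω₁ - ω₂ ∉ periodLattice ω₁ ω₂ := by
      simpa [sub_eq_add_neg] using (int_mul_add_int_mul_mem_iff hω (a := 1) (b := -1)).not.mpr
        (by simp)
    -- The class of λ modulo the lattice already separates the four points: their λ differ by
    -- half-periods outside it.
    have hne : ∀ {z l z' l' : ℂ} (w : ℂ), w ∉ periodLattice ω₁ ω₂ → l - l' = w →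
        point ω₁ ω₂ η z l ≠ point ω₁ ω₂ η z' l' := by
      intro z l z' l' w hw hl
      refine point_ne_of_sub_notMem fun h => hw ?_
      rw [← hl, ← neg_sub]
      exact neg_mem h
    rw [Set.ncard_insert_of_notMem, Set.ncard_insert_of_notMem, Set.ncard_pair]
    · exact hne ω₁ h1 (by ring)
    · simp only [Set.mem_insert_iff, Set.mem_singleton_iff, not_or]
      refine ⟨(hne (ω₁ - ω₂) h4 (by ring)).symm, hne ω₂ h2 (by ring)⟩
    · simp only [Set.mem_insert_iff, Set.mem_singleton_iff, not_or]
      exact ⟨hne ω₁ h1 (by ring), hne ω₂ h2 (by ring), hne (ω₁ + ω₂) h3 (by ring)⟩
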